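/- There are absolute constants \(C, c > 0\) such that the following holds for all \(n\) and \(K\). Let \(\mathbf{B} \in [0,1]^{K \times K}\) be symmetric of full rank, and let \(\Theta \in [0,1]^{n \times K}\) have rows that sum to \(1\) and at least one "pure" node for each community: for every \(k\) there is an \(i\) with \(\Theta_{ik} = 1\). Put \(\mathbf{P} = \Theta \mathbf{B} \Theta^{\mathrm T}\), let \(\mathbf{U} \in \mathbb{R}^{n \times K}\) be a matrix of orthonormal eigenvectors of \(\mathbf{P}\) for its \(K\) eigenvalues of largest absolute value, and let \(\mathbf{F} \in \mathbb{R}^{K\times K}\) be the matrix with \(\mathbf{U} = \Theta \mathbf{F}\). Write \(\|\cdot\|\) for the spectral norm (the Euclidean norm for vectors), \(\|\cdot\|_F\) for the Frobenius norm, \(\lambda_k(M)\) for the \(k\)-th largest singular value, and \(\kappa(M) = \lambda_1(M)/\lambda_K(M)\) for a matrix \(M\) of rank \(K\). Let \(\mathbf{A}\) be a real symmetric \(n \times n\) matrix (for instance the adjacency matrix of a graph) and \[ \beta(\mathbf{A},\mathbf{P}) = \max_{1 \le i \le n} \Bigl( 23 K^{1/2} \kappa(\mathbf{P}) \frac{\|\mathbf{e}_i^{\mathrm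 T}\mathbf{A}\| \, \|\mathbf{A}-\mathbf{P}\|}{\lambda_K^2(\mathbf{P})} + \frac{\|\mathbf{e}_i^{\mathrm T}(\mathbf{A}-\mathbf{P})\mathbf{U}\|}{\lambda_K(\mathbf{P})} \Bigr). \] Assume that \(\|\mathbf{A}-\mathbf{P}\| \le \frac12 \lambda_K(\mathbf{P})\) and \(\beta(\mathbf{A},\mathbf{P}) \le c\, \lambda_K(\mathbf{F})/K^{1/2}\). The SPOC algorithm with input \((\mathbf{A}, K)\) computes orthonormal eigenvectors \(\hat{\mathbf{U}} \in \mathbb{R}^{n\times K}\) of \(\mathbf{A}\) for \(K\) eigenvalues of largest absolute value, with the diagonal matrix \(\hat{\mathbf{L}}\) of these eigenvalues; finds a set \(J\) of \(K\) row indices by the preconditioned successive projection algorithm (transform the rows of \(\hat{\mathbf{U}}\) by the positive definite matrix that maps the minimum-volume origin-centred ellipsoid containing them to the unit ball; then repeatedly select a transformed row whose projection on the orthogonal complement of the already selected ones has the largest norm); and returns \(\hat{\mathbf{B}} = \hat{\mathbf{F}} \hat{\mathbf{L}} \hat{\mathbf{F}}^{\mathrm T}\) with \(\hat{\mathbf{F}}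 = \hat{\mathbf{U}}[J,:]\). Then, for every choice of eigenvectors and of tie-breaking, there is a permutation matrix \(\Pi_{\mathbf{F}}\) with \[ \bigl\|\hat{\mathbf{B}} - \Pi_{\mathbf{F}} \mathbf{B} \Pi_{\mathbf{F}}^{\mathrm T}\bigr\|_F \le C K^{1/2} \kappa(\Theta) \frac{\|\mathbf{P}\|}{\lambda_K(\Theta)} \beta(\mathbf{A},\mathbf{P}) + C K^{1/2} \kappa(\mathbf{P}) \frac{\|\mathbf{A}-\mathbf{P}\|}{\lambda_K^2(\Theta)}. \] -/

import Mathlib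

open scoped Matrix Matrix.Norms.L2Operator

noncomputable section

namespace SPOC

/-- The `k`-th largest singular value of a real matrix, counted from `k = 1`. -/
def singVal {m n : ℕ} (k : ℕ) (M : Matrix (Fin m) (Fin n) ℝ) : ℝ :=
  (Matrix.toEuclideanLin M).singularValues (k - 1)

/-- The condition number `λ_max / λ_K` of a matrix of rank `K`: the ratio of the largest singular
value to the `K`-th largest (that is, the smallest non-zero) one. -/
def condNum {m n : ℕ} (K : ℕ) (M : Matrix (Fin m) (Fin n) ℝ) : ℝ :=
  singVal 1 M / singVal K M

/-- The Frobenius norm. (The notation `‖M‖` for a matrix is the spectral norm.) -/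
def frobNorm {m n : ℕ} (M : Matrix (Fin m) (Fin n) ℝ) : ℝ :=
  √(∑ i, ∑ j, M i j ^ 2)

/-- The `i`-th row of a matrix as a Euclidean vector. -/
def rowVec {m n : ℕ} (M : Matrix (Fin m) (Fin n) ℝ) (i : Fin m) : EuclideanSpace ℝ (Fin n) :=
  WithLp.toLp 2 (M i)

/-- Parameters `Θ`, `B` of a mixed membership stochastic block model that satisfy the
identifiability conditions. -/
structure IsIdentifiable {n K : ℕ} (Θ : Matrix (Fin n) (Fin K) ℝ)
    (B : Matrix (Fin K) (Fin K) ℝ) : Prop where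
  membership_mem : ∀ i k, Θ i k ∈ Set.Icc (0 : ℝ) 1
  row_sum : ∀ i, ∑ k, Θ i k = 1
  pure_node : ∀ k, ∃ i, Θ i k = 1
  symm : B.IsSymm
  prob_mem : ∀ k l, B k l ∈ Set.Icc (0 : ℝ) 1
  full_rank : B.rank = K

/-- The matrix `P = Θ B Θᵀ` of edge probabilities. -/
def probMatrix {n K : ℕ} (Θ : Matrix (Fin n) (Fin K) ℝ) (B : Matrix (Fin K) (Fin K) ℝ) :
    Matrix (Fin n) (Fin n) ℝ :=
  Θ * B * Θᵀ

/-- `U diag(l) Uᵀ` is a rank-`K` eigenvalue decomposition of the symmetric matrix `A`: the columns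
of `U` are orthonormal eigenvectors of `A` with eigenvalues `l`, and these are `K` leading
eigenvalues, i.e. `K` eigenvalues (with multiplicity) of largest absolute value: an eigenvector
orthogonal to the columns of `U` has an eigenvalue of no larger modulus. -/
structure IsLeadingEigen {n K : ℕ} (A : Matrix (Fin n) (Fin n) ℝ)
    (U : Matrix (Fin n) (Fin K) ℝ) (l : Fin K → ℝ) : Prop where
  orthonormal : Uᵀ * U = 1
  eigen : A * U = U * Matrix.diagonal l
  leading : ∀ (x : Fin n → ℝ) (μ : ℝ), x ≠ 0 → Uᵀ *ᵥ x = 0 → A *ᵥ x = μ • x → ∀ k, |μ| ≤ |l k|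

/-- `β_i(A, P)`, where the columns of `U` are the `K` leading eigenvectors of `P`. -/
def betaRow {n K : ℕ} (A P : Matrix (Fin n) (Fin n) ℝ) (U : Matrix (Fin n) (Fin K) ℝ)
    (i : Fin n) : ℝ :=
  23 * √K * condNum K P * (‖rowVec A i‖ * ‖A - P‖ / singVal K P ^ 2)
    + ‖rowVec ((A - P) * U) i‖ / singVal K P

/-- `β(A, P) = max_i β_i(A, P)`. -/
def beta {n K : ℕ} (A P : Matrix (Fin n) (Fin n) ℝ) (U : Matrix (Fin n) (Fin K) ℝ) : ℝ :=
  ⨆ i, betaRow A P U i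

/-- The preconditioner of the points `g i`: `{x | ‖Q x‖ ≤ 1}`, with `Q` positive definite, is an
ellipsoid of minimal volume among the ellipsoids centred at the origin that contain all `g i`
(its volume is proportional to `1 / det Q`). -/
structure IsPreconditioner {n K : ℕ} (g : Fin n → EuclideanSpace ℝ (Fin K))
    (Q : Matrix (Fin K) (Fin K) ℝ) : Prop where
  posDef : Q.PosDef
  contains : ∀ i, ‖Matrix.toEuclideanLin Q (g i)‖ ≤ 1
  minimal : ∀ Q' : Matrix (Fin K) (Fin K) ℝ, Q'.PosDef →
    (∀ i, ‖Matrix.toEuclideanLin Q' (g i)‖ ≤ 1) → Q'.det ≤ Q.det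

/-- `J 0, …, J (K - 1)` are indices successively chosen by the successive projection algorithm
(without preconditioning) for the points `g i`: at every step, an index is taken for which the
projection of the point on the orthogonal complement of the points taken before has maximal norm.
Ties may be broken in any way. -/
def IsSPAChoice {n K : ℕ} {E : Type*} [NormedAddCommGroup E] [InnerProductSpace ℝ E]
    [FiniteDimensional ℝ E] (g : Fin n → E) (J : Fin K → Fin n) : Prop :=
  ∀ k i, ‖(Submodule.span ℝ ((fun k' => g (J k')) '' Set.Iio k))ᗮ.starProjection (g i)‖
    ≤ ‖(Submodule.span ℝ ((fun k' => g (J k')) '' Set.Iio k))ᗮ.starProjection (g (J k))‖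

/-- `J` is an output of the preconditioned successive projection algorithm for the points `g i`. -/
def IsPreconditionedSPAOutput {n K : ℕ} (g : Fin n → EuclideanSpace ℝ (Fin K))
    (J : Fin K → Fin n) : Prop :=
  ∃ Q, IsPreconditioner g Q ∧ IsSPAChoice (fun i => Matrix.toEuclideanLin Q (g i)) J

/-- `Bhat` is a matrix that the SPOC algorithm with input `(A, K)` can return: with a rank-`K`
eigenvalue decomposition `Uhat`, `lhat` of `A` and a set `J` of row indices found by the
preconditioned successive projection algorithm for the rows of `Uhat`, one puts
`Fhat = Uhat[J, :]` and `Bhat = Fhat diag(lhat) Fhatᵀ`. -/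
def IsSPOCOutput {n K : ℕ} (A : Matrix (Fin n) (Fin n) ℝ) (Bhat : Matrix (Fin K) (Fin K) ℝ) :
    Prop :=
  ∃ (Uhat : Matrix (Fin n) (Fin K) ℝ) (lhat : Fin K → ℝ) (J : Fin K → Fin n),
    IsLeadingEigen A Uhat lhat ∧ IsPreconditionedSPAOutput (rowVec Uhat) J ∧
    Bhat = Uhat.submatrix J id * Matrix.diagonal lhat * (Uhat.submatrix J id)ᵀ

end SPOC

end

/-! Write `V` for the computed eigenvectors, `d` for their eigenvalues, `H = Uᵀ V`. Row by row, `V`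
differs from `U H = Θ (F H)` by at most `β` (`norm_rowVec_eigenvectors_sub_le`). Up to `β`, the rows
of `V` are thus convex combinations of the `K` rows of `F H`, and pure nodes lie near these
vertices.

Vertex hunting is stable. In coordinates where chosen pure rows of `V` are exactly the unit vectors,
every row is within `η`, of order `‖Θ‖ β`, of its membership vector. Minimal ellipsoids are
equivariant under linear maps, so it suffices that in these coordinates the preconditioner `R`
distorts norms by a factor at most `2` once `√K η` is small (`minVolume_bounds`). Rescaling the unit
ball to contain all points would need `K η` small. Instead, put mass one on each cluster of points
near a vertex, so as to maximise the determinant of the second moment matrix `S`. By first-order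
optimality no leverage `yᵀ S⁻¹ y` in a cluster exceeds the cluster mean, which is at most `1` plus a
variance `O(η²)`; points away from the vertices obey the same bound by strict convexity. Hence `S⁻¹`
is feasible up to a factor `1 + O(η²)`, and `R S Rᵀ` has trace at most `K` and determinant at least
`exp (-O(K η²))`. This is near-equality in AM-GM, so all its eigenvalues are near `1`.

Successive projection then works on well-conditioned vertices (`exists_vertex_of_max_residual`). A
convex combination whose residual norm is nearly maximal cannot spread its weight over vertices with
distant residuals. So one new vertex carries weight `1 - O(η)`, with the same constant at every
step: errors do not accumulate.

Finally `B = F diag(l) Fᵀ`, as seen at pure nodes. Replacing `Fhat` by the permuted `F H` gives the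
first error term; comparing `H diag(d) Hᵀ` with `diag(l)` (`norm_conj_diagonal_sub_le`) gives the
second. -/

namespace SPOC

/-! ### Spectral, Frobenius and row norms -/

section Norms

open WithLp

variable {m n k : ℕ}

theorem norm_toLp_sq (x : Fin n → ℝ) : ‖toLp 2 x‖ ^ 2 = x ⬝ᵥ x := by
  rw [EuclideanSpace.norm_sq_eq]
  simp [dotProduct, sq]

theorem norm_mulVec_le (M : Matrix (Fin m) (Fin n) ℝ) (x : Fin n → ℝ) :
    ‖toLp 2 (M *ᵥ x)‖ ≤ ‖M‖ * ‖toLp 2 x‖ :=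
  Matrix.l2_opNorm_mulVec M (toLp 2 x)

theorem opNorm_le_of_mulVec {M : Matrix (Fin m) (Fin n) ℝ} {c : ℝ} (hc : 0 ≤ c)
    (h : ∀ x : Fin n → ℝ, ‖toLp 2 (M *ᵥ x)‖ ≤ c * ‖toLp 2 x‖) : ‖M‖ ≤ c := by
  rw [Matrix.l2_opNorm_def]
  refine ContinuousLinearMap.opNorm_le_bound _ hc fun x => ?_
  exact h (ofLp x)

theorem norm_transpose_eq (M : Matrix (Fin m) (Fin n) ℝ) : ‖Mᵀ‖ = ‖M‖ := by
  rw [← Matrix.l2_opNorm_conjTranspose M, Matrix.conjTranspose_eq_transpose_of_trivial]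

theorem norm_diagonal_le {d : Fin n → ℝ} {c : ℝ} (hc : 0 ≤ c) (h : ∀ i, |d i| ≤ c) :
    ‖(Matrix.diagonal d : Matrix (Fin n) (Fin n) ℝ)‖ ≤ c := by
  rw [Matrix.l2_opNorm_diagonal]
  exact (pi_norm_le_iff_of_nonneg hc).2 h

theorem norm_le_one_of_transpose_mul_self {U : Matrix (Fin m) (Fin n) ℝ} (h : Uᵀ * U = 1) :
    ‖U‖ ≤ 1 := by
  refine opNorm_le_of_mulVec zero_le_one fun x => ?_
  rw [one_mul]
  refine le_of_eq ((sq_eq_sq₀ (norm_nonneg _) (norm_nonneg _)).1 ?_)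
  rw [norm_toLp_sq, norm_toLp_sq, Matrix.dotProduct_mulVec, ← Matrix.mulVec_transpose,
    Matrix.mulVec_mulVec, h, Matrix.one_mulVec]

theorem norm_mulVec_of_transpose_mul_self {U : Matrix (Fin m) (Fin n) ℝ} (h : Uᵀ * U = 1)
    (x : Fin n → ℝ) : ‖toLp 2 (U *ᵥ x)‖ = ‖toLp 2 x‖ := by
  refine (sq_eq_sq₀ (norm_nonneg _) (norm_nonneg _)).1 ?_
  rw [norm_toLp_sq, norm_toLp_sq, Matrix.dotProduct_mulVec, ← Matrix.mulVec_transpose,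
    Matrix.mulVec_mulVec, h, Matrix.one_mulVec]

theorem rowVec_mul (M : Matrix (Fin m) (Fin n) ℝ) (N : Matrix (Fin n) (Fin k) ℝ) (i : Fin m) :
    rowVec (M * N) i = toLp 2 (Nᵀ *ᵥ M i) := by
  rw [Matrix.mulVec_transpose]; rfl

theorem norm_rowVec_mul_le (M : Matrix (Fin m) (Fin n) ℝ) (N : Matrix (Fin n) (Fin k) ℝ)
    (i : Fin m) : ‖rowVec (M * N) i‖ ≤ ‖rowVec M i‖ * ‖N‖ := by
  rw [rowVec_mul, ← norm_transpose_eq N, mul_comm]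
  exact norm_mulVec_le _ _

theorem rowVec_add (M N : Matrix (Fin m) (Fin n) ℝ) (i : Fin m) :
    rowVec (M + N) i = rowVec M i + rowVec N i := rfl

theorem rowVec_sub (M N : Matrix (Fin m) (Fin n) ℝ) (i : Fin m) :
    rowVec (M - N) i = rowVec M i - rowVec N i := rfl

theorem norm_rowVec_sq (M : Matrix (Fin m) (Fin n) ℝ) (i : Fin m) :
    ‖rowVec M i‖ ^ 2 = ∑ j, M i j ^ 2 := by
  simp [rowVec, EuclideanSpace.norm_sq_eq]

theorem frobNorm_nonneg (M : Matrix (Fin m) (Fin n) ℝ) : 0 ≤ frobNorm M := Real.sqrt_nonneg _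

theorem frobNorm_sq (M : Matrix (Fin m) (Fin n) ℝ) :
    frobNorm M ^ 2 = ∑ i, ‖rowVec M i‖ ^ 2 := by
  rw [frobNorm, Real.sq_sqrt (by positivity)]
  simp [norm_rowVec_sq]

theorem frobNorm_transpose (M : Matrix (Fin m) (Fin n) ℝ) : frobNorm Mᵀ = frobNorm M := by
  rw [frobNorm, frobNorm, Finset.sum_comm]; rfl

theorem frobNorm_add_le (M N : Matrix (Fin m) (Fin n) ℝ) :
    frobNorm (M + N) ≤ frobNorm M + frobNorm N := by
  have key : ∀ M : Matrix (Fin m) (Fin n) ℝ,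
      frobNorm M = ‖(toLp 2 (fun p : Fin m × Fin n => M p.1 p.2) : EuclideanSpace ℝ _)‖ := by
    intro M
    rw [EuclideanSpace.norm_eq, frobNorm, Fintype.sum_prod_type]
    simp
  rw [key, key, key]
  exact norm_add_le (toLp 2 fun p : Fin m × Fin n => M p.1 p.2)
    (toLp 2 fun p : Fin m × Fin n => N p.1 p.2)

theorem frobNorm_mul_le_left (M : Matrix (Fin m) (Fin n) ℝ) (N : Matrix (Fin n) (Fin k) ℝ) :
    frobNorm (M * N) ≤ frobNorm M * ‖N‖ := by
  refine le_of_sq_le_sq ?_ (mul_nonneg (frobNorm_nonneg _) (norm_nonneg _))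
  rw [mul_pow, frobNorm_sq, frobNorm_sq, Finset.sum_mul]
  refine Finset.sum_le_sum fun i _ => ?_
  rw [← mul_pow]
  exact pow_le_pow_left₀ (norm_nonneg _) (norm_rowVec_mul_le _ _ _) 2

theorem frobNorm_mul_le_right (M : Matrix (Fin m) (Fin n) ℝ) (N : Matrix (Fin n) (Fin k) ℝ) :
    frobNorm (M * N) ≤ ‖M‖ * frobNorm N := by
  rw [← frobNorm_transpose, Matrix.transpose_mul, ← norm_transpose_eq M, ← frobNorm_transpose N,
    mul_comm]
  exact frobNorm_mul_le_left _ _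

theorem frobNorm_le_of_rowVec {M : Matrix (Fin m) (Fin n) ℝ} {ρ : ℝ} (hρ : 0 ≤ ρ)
    (h : ∀ i, ‖rowVec M i‖ ≤ ρ) : frobNorm M ≤ √m * ρ := by
  refine le_of_sq_le_sq ?_ (by positivity)
  rw [frobNorm_sq, mul_pow, Real.sq_sqrt (by positivity)]
  calc ∑ i, ‖rowVec M i‖ ^ 2 ≤ ∑ _i : Fin m, ρ ^ 2 :=
        Finset.sum_le_sum fun i _ => pow_le_pow_left₀ (norm_nonneg _) (h i) 2
    _ = m * ρ ^ 2 := by simp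

theorem norm_rowVec_le (M : Matrix (Fin m) (Fin n) ℝ) (i : Fin m) : ‖rowVec M i‖ ≤ ‖M‖ := by
  have h : rowVec M i = toLp 2 (Mᵀ *ᵥ Pi.single i 1) := by
    rw [Matrix.mulVec_single_one]; rfl
  rw [h, ← norm_transpose_eq M]
  refine (norm_mulVec_le _ _).trans ?_
  have : ‖toLp 2 (Pi.single i (1 : ℝ) : Fin m → ℝ)‖ = 1 := by
    exact (PiLp.norm_single 2 (fun _ : Fin m => ℝ) i (1 : ℝ)).trans (by simp)
  rw [this, mul_one]

theorem frobNorm_le_sqrt_mul_norm (M : Matrix (Fin m) (Fin n) ℝ) : frobNorm M ≤ √m * ‖M‖ :=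
  frobNorm_le_of_rowVec (norm_nonneg _) (norm_rowVec_le M)

theorem norm_le_frobNorm (M : Matrix (Fin m) (Fin n) ℝ) : ‖M‖ ≤ frobNorm M := by
  refine opNorm_le_of_mulVec (frobNorm_nonneg _) fun x => ?_
  refine le_of_sq_le_sq ?_ (mul_nonneg (frobNorm_nonneg _) (norm_nonneg _))
  rw [mul_pow, frobNorm_sq, Finset.sum_mul, EuclideanSpace.norm_sq_eq]
  refine Finset.sum_le_sum fun i _ => ?_
  have h : (M *ᵥ x) i = inner ℝ (rowVec M i) (toLp 2 x) := by
    simp [Matrix.mulVec, dotProduct, rowVec, PiLp.inner_apply, mul_comm]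
  rw [← mul_pow]
  refine pow_le_pow_left₀ (norm_nonneg _) ?_ 2
  change ‖(M *ᵥ x) i‖ ≤ _
  rw [h]
  exact norm_inner_le_norm _ _

theorem norm_submatrix_equiv_le (M : Matrix (Fin m) (Fin n) ℝ) (σ : Equiv.Perm (Fin m)) :
    ‖M.submatrix σ id‖ ≤ ‖M‖ := by
  refine opNorm_le_of_mulVec (norm_nonneg _) fun x => ?_
  refine le_trans (le_of_eq ?_) (norm_mulVec_le M x)
  rw [EuclideanSpace.norm_eq, EuclideanSpace.norm_eq]
  congr 1
  exact Equiv.sum_comp σ fun i => ‖(M *ᵥ x) i‖ ^ 2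

end Norms

/-! ### Singular values and symmetric eigenvalues -/

section SingularValues

open WithLp LinearMap

variable {m n : ℕ}

theorem norm_apply_sq_eq_sum_singularValues {E F : Type*}
    [NormedAddCommGroup E] [InnerProductSpace ℝ E] [FiniteDimensional ℝ E]
    [NormedAddCommGroup F] [InnerProductSpace ℝ F] [FiniteDimensional ℝ F]
    (T : E →ₗ[ℝ] F) {d : ℕ} (hd : Module.finrank ℝ E = d) (x : E) :
    ‖T x‖ ^ 2 = ∑ i : Fin d, T.singularValues i ^ 2 *
      (T.isSymmetric_adjoint_comp_self.eigenvectorBasis hd).repr x i ^ 2 := by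
  set v := T.isSymmetric_adjoint_comp_self.eigenvectorBasis hd
  have h1 : ‖T x‖ ^ 2 = inner ℝ x ((adjoint T ∘ₗ T) x) := by
    rw [← real_inner_self_eq_norm_sq, LinearMap.comp_apply, adjoint_inner_right]
  rw [h1, ← v.repr.inner_map_map, PiLp.inner_apply]
  refine Finset.sum_congr rfl fun i _ => ?_
  rw [T.isSymmetric_adjoint_comp_self.eigenvectorBasis_apply_self_apply hd x i,
    T.sq_singularValues_fin hd]
  simp
  ring

theorem norm_le_singVal_one (M : Matrix (Fin m) (Fin n) ℝ) : ‖M‖ ≤ singVal 1 M := by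
  have h0 : 0 ≤ singVal 1 M := singularValues_nonneg _ _
  refine opNorm_le_of_mulVec h0 fun x => ?_
  refine le_of_sq_le_sq ?_ (mul_nonneg h0 (norm_nonneg _))
  have hd : Module.finrank ℝ (EuclideanSpace ℝ (Fin n)) = n := by simp
  have := norm_apply_sq_eq_sum_singularValues (Matrix.toEuclideanLin M) hd (toLp 2 x)
  change ‖toLp 2 (M *ᵥ x)‖ ^ 2 = _ at this
  rw [this, mul_pow, ← (LinearIsometryEquiv.norm_map
    ((Matrix.toEuclideanLin M).isSymmetric_adjoint_comp_self.eigenvectorBasis hd).repr (toLp 2 x)),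
    EuclideanSpace.norm_sq_eq, Finset.mul_sum]
  refine Finset.sum_le_sum fun i _ => ?_
  rw [Real.norm_eq_abs, sq_abs]
  gcongr
  · exact singularValues_nonneg _ _
  · exact singularValues_antitone _ (Nat.zero_le _)

theorem singVal_mul_norm_le (M : Matrix (Fin m) (Fin n) ℝ) (x : Fin n → ℝ) :
    singVal n M * ‖toLp 2 x‖ ≤ ‖toLp 2 (M *ᵥ x)‖ := by
  refine le_of_sq_le_sq ?_ (norm_nonneg _)
  have hd : Module.finrank ℝ (EuclideanSpace ℝ (Fin n)) = n := by simp
  have := norm_apply_sq_eq_sum_singularValues (Matrix.toEuclideanLin M) hd (toLp 2 x)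
  change ‖toLp 2 (M *ᵥ x)‖ ^ 2 = _ at this
  rw [this, mul_pow, ← (LinearIsometryEquiv.norm_map
    ((Matrix.toEuclideanLin M).isSymmetric_adjoint_comp_self.eigenvectorBasis hd).repr (toLp 2 x)),
    EuclideanSpace.norm_sq_eq, Finset.mul_sum]
  refine Finset.sum_le_sum fun i _ => ?_
  rw [Real.norm_eq_abs, sq_abs]
  gcongr
  · exact singularValues_nonneg _ _
  -- Indices start at `0`, so `n - 1` is the index of the smallest of the `n` singular values.
  · exact singularValues_antitone _ (by omega)

/-- There are `K - 1` linear conditions on `K` unknowns. This is the dimension count behind the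
min-max arguments for `IsLeadingEigen.singVal_le` and `IsLeadingEigen.singVal_sub_le`. -/
theorem exists_ne_zero_mulVec_eq_zero_of_ne {K : ℕ} (M : Matrix (Fin K) (Fin K) ℝ) (k : Fin K) :
    ∃ a : Fin K → ℝ, a ≠ 0 ∧ ∀ j, j ≠ k → (M *ᵥ a) j = 0 := by
  by_cases hM : M.det = 0
  · obtain ⟨a, ha, h⟩ := Matrix.exists_mulVec_eq_zero_iff.2 hM
    exact ⟨a, ha, fun j _ => by rw [h]; rfl⟩
  · have hu : IsUnit M.det := isUnit_iff_ne_zero.2 hM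
    refine ⟨M⁻¹ *ᵥ Pi.single k 1, fun h => ?_, fun j hj => ?_⟩
    · have := congrArg (fun a => (M *ᵥ a) k) h
      rw [Matrix.mulVec_mulVec, Matrix.mul_nonsing_inv _ hu] at this
      simp at this
    · rw [Matrix.mulVec_mulVec, Matrix.mul_nonsing_inv _ hu]
      simp [hj]

/-- A symmetric matrix all of whose eigenvalues have modulus at most `c` has norm at most `c`. -/
theorem norm_mulVec_le_of_eigenvalue_le {T : Matrix (Fin n) (Fin n) ℝ} (hT : T.IsSymm) {c : ℝ}
    (hc : 0 ≤ c) (h : ∀ (x : Fin n → ℝ) (μ : ℝ), x ≠ 0 → T *ᵥ x = μ • x → |μ| ≤ c)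
    (x : Fin n → ℝ) : ‖toLp 2 (T *ᵥ x)‖ ≤ c * ‖toLp 2 x‖ := by
  have hH : T.IsHermitian := by
    rw [Matrix.IsHermitian, Matrix.conjTranspose_eq_transpose_of_trivial]; exact hT
  have hS : (Matrix.toEuclideanLin T).IsSymmetric := Matrix.isSymmetric_toEuclideanLin_iff.2 hH
  have hd : Module.finrank ℝ (EuclideanSpace ℝ (Fin n)) = n := by simp
  set v := hS.eigenvectorBasis hd
  have hev : ∀ i, |hS.eigenvalues hd i| ≤ c := by
    intro i
    refine h (ofLp (v i)) _ ?_ ?_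
    · intro h0
      have : v i = 0 := by ext j; exact congrFun h0 j
      exact v.toBasis.ne_zero i (by simpa using this)
    · have := hS.apply_eigenvectorBasis hd i
      exact congrArg ofLp this
  refine le_of_sq_le_sq ?_ (mul_nonneg hc (norm_nonneg _))
  change ‖Matrix.toEuclideanLin T (toLp 2 x)‖ ^ 2 ≤ _
  rw [← v.repr.norm_map, mul_pow, ← v.repr.norm_map (toLp 2 x), EuclideanSpace.norm_sq_eq,
    EuclideanSpace.norm_sq_eq, Finset.mul_sum]
  refine Finset.sum_le_sum fun i _ => ?_
  rw [hS.eigenvectorBasis_apply_self_apply hd, norm_mul, mul_pow]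
  gcongr
  exact hev i

end SingularValues

/-! ### Leading eigenvalues: min-max and Weyl's inequality -/

section LeadingEigen

open WithLp LinearMap

variable {n K : ℕ} {A P : Matrix (Fin n) (Fin n) ℝ} {U : Matrix (Fin n) (Fin K) ℝ} {l : Fin K → ℝ}

theorem IsLeadingEigen.transpose_mul (h : IsLeadingEigen A U l) (hA : A.IsSymm) :
    Uᵀ * A = Matrix.diagonal l * Uᵀ := by
  have := congrArg Matrix.transpose h.eigen
  rwa [Matrix.transpose_mul, Matrix.transpose_mul, hA.eq, Matrix.diagonal_transpose] at this

/-- The part of a symmetric matrix beyond its leading eigenvectors is small. -/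
theorem IsLeadingEigen.norm_residual_mulVec_le (h : IsLeadingEigen A U l) (hA : A.IsSymm)
    (k : Fin K) (x : Fin n → ℝ) :
    ‖toLp 2 ((A - U * Matrix.diagonal l * Uᵀ) *ᵥ x)‖ ≤ |l k| * ‖toLp 2 x‖ := by
  have hUT : Uᵀ * (A - U * Matrix.diagonal l * Uᵀ) = 0 := by
    rw [Matrix.mul_sub, h.transpose_mul hA, ← Matrix.mul_assoc, ← Matrix.mul_assoc, h.orthonormal,
      Matrix.one_mul, sub_self]
  refine norm_mulVec_le_of_eigenvalue_le ?_ (abs_nonneg _) ?_ x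
  · rw [Matrix.IsSymm, Matrix.transpose_sub, hA.eq, Matrix.transpose_mul, Matrix.transpose_mul,
      Matrix.transpose_transpose, Matrix.diagonal_transpose, Matrix.mul_assoc]
  · intro x μ hx hμ
    -- An eigenvector of the residual with nonzero eigenvalue is orthogonal to the columns of `U`,
    -- hence is an eigenvector of `A`, and `leading` applies.
    by_cases h0 : μ = 0
    · simp [h0]
    have h1 : Uᵀ *ᵥ x = 0 := by
      have : μ • (Uᵀ *ᵥ x) = 0 := by
        rw [← Matrix.mulVec_smul, ← hμ, Matrix.mulVec_mulVec, hUT, Matrix.zero_mulVec]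
      exact (smul_eq_zero.1 this).resolve_left h0
    refine h.leading x μ hx h1 ?_ k
    rw [← hμ, Matrix.sub_mulVec, ← Matrix.mulVec_mulVec, h1, Matrix.mulVec_zero, sub_zero]

/-- Such an `x` is the orthogonal sum of a multiple of the `k`-th leading eigenvector and a vector
orthogonal to all of them. `A` respects this splitting and expands neither part by more than `|l
k|`. -/
theorem IsLeadingEigen.norm_mulVec_le_of_orthogonal (h : IsLeadingEigen A U l) (hA : A.IsSymm)
    (k : Fin K) {x : Fin n → ℝ} (hx : ∀ j, j ≠ k → (Uᵀ *ᵥ x) j = 0) :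
    ‖toLp 2 (A *ᵥ x)‖ ≤ |l k| * ‖toLp 2 x‖ := by
  set y := Uᵀ *ᵥ x with hy
  set w := x - U *ᵥ y with hw
  set T := A - U * Matrix.diagonal l * Uᵀ with hT
  have hUT : Uᵀ * T = 0 := by
    rw [hT, Matrix.mul_sub, h.transpose_mul hA, ← Matrix.mul_assoc, ← Matrix.mul_assoc, h.orthonormal,
      Matrix.one_mul, sub_self]
  have hUw : Uᵀ *ᵥ w = 0 := by
    rw [hw, Matrix.mulVec_sub, Matrix.mulVec_mulVec, h.orthonormal, Matrix.one_mulVec, sub_self]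
  have hly : Matrix.diagonal l *ᵥ y = l k • y := by
    ext j
    by_cases hj : j = k
    · simp [Matrix.mulVec_diagonal, hj]
    · simp [Matrix.mulVec_diagonal, hx j hj]
  have hAx : A *ᵥ x = T *ᵥ w + U *ᵥ (l k • y) := by
    have hxw : x = w + U *ᵥ y := by rw [hw]; abel
    have hTw : T *ᵥ w = A *ᵥ w := by
      rw [hT, Matrix.sub_mulVec, ← Matrix.mulVec_mulVec, hUw, Matrix.mulVec_zero, sub_zero]
    conv_lhs => rw [hxw]
    rw [Matrix.mulVec_add, hTw, Matrix.mulVec_mulVec, h.eigen, ← Matrix.mulVec_mulVec, hly]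
  have pyth : ∀ (u : Fin n → ℝ) (v : Fin K → ℝ), Uᵀ *ᵥ u = 0 →
      ‖toLp 2 (u + U *ᵥ v)‖ ^ 2 = ‖toLp 2 u‖ ^ 2 + ‖toLp 2 v‖ ^ 2 := by
    intro u v hu
    have h1 : u ⬝ᵥ (U *ᵥ v) = 0 := by
      rw [Matrix.dotProduct_mulVec, ← Matrix.mulVec_transpose, hu, zero_dotProduct]
    rw [← norm_mulVec_of_transpose_mul_self h.orthonormal v, norm_toLp_sq, norm_toLp_sq,
      norm_toLp_sq, add_dotProduct, dotProduct_add, dotProduct_add, h1,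
      dotProduct_comm (U *ᵥ v) u, h1]
    ring
  refine le_of_sq_le_sq ?_ (by positivity)
  have hxn : ‖toLp 2 x‖ ^ 2 = ‖toLp 2 w‖ ^ 2 + ‖toLp 2 y‖ ^ 2 := by
    rw [← pyth w y hUw, hw, sub_add_cancel]
  have hTn := h.norm_residual_mulVec_le hA k w
  rw [hAx, pyth _ _ (by rw [Matrix.mulVec_mulVec, hUT, Matrix.zero_mulVec]), mul_pow, hxn,
    toLp_smul, norm_smul, mul_pow, Real.norm_eq_abs, mul_add, ← mul_pow]
  gcongr ?_ + _
  rw [← mul_pow]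
  exact pow_le_pow_left₀ (norm_nonneg _) hTn 2

/-- The span of the top `K` right singular vectors contains a nonzero vector orthogonal to all
columns of `U` but the `k`-th; `A` expands it by at least `singVal K A` and at most `|l k|`. -/
theorem IsLeadingEigen.singVal_le (h : IsLeadingEigen A U l) (hA : A.IsSymm) (k : Fin K) :
    singVal K A ≤ |l k| := by
  have hd : Module.finrank ℝ (EuclideanSpace ℝ (Fin n)) = n := by simp
  by_cases hn : n ≤ K - 1
  · rw [singVal, singularValues_of_finrank_le _ (by rw [hd]; exact hn)]
    exact abs_nonneg _
  push Not at hn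
  have hKn : K ≤ n := by have := k.pos; omega
  set v := (Matrix.toEuclideanLin A).isSymmetric_adjoint_comp_self.eigenvectorBasis hd
  obtain ⟨a, ha0, ha⟩ := exists_ne_zero_mulVec_eq_zero_of_ne
    (Uᵀ * Matrix.of fun (i : Fin n) (j : Fin K) => v (Fin.castLE hKn j) i) k
  set x : EuclideanSpace ℝ (Fin n) := ∑ j, a j • v (Fin.castLE hKn j) with hx
  have hxM : (Matrix.of fun (i : Fin n) (j : Fin K) => v (Fin.castLE hKn j) i) *ᵥ a = ofLp x := by
    ext i
    simp [hx, Matrix.mulVec, dotProduct, mul_comm]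
  have hup := h.norm_mulVec_le_of_orthogonal hA k (x := ofLp x) fun j hj => by
    rw [← hxM, Matrix.mulVec_mulVec]; exact ha j hj
  have hrep : ∀ i : Fin n, v.repr x i = if hi : (i : ℕ) < K then a ⟨i, hi⟩ else 0 := by
    intro i
    simp only [hx, map_sum, map_smul, v.repr_self, WithLp.ofLp_sum, Finset.sum_apply,
      PiLp.smul_apply, PiLp.single_apply, smul_eq_mul, mul_ite, mul_one, mul_zero]
    split_ifs with hi
    · rw [Finset.sum_eq_single ⟨i, hi⟩]
      · simp
      · intro j _ hj
        rw [if_neg]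
        rintro rfl
        exact hj rfl
      · simp
    · refine Finset.sum_eq_zero fun j _ => if_neg ?_
      rintro rfl
      exact hi j.2
  have hlow : singVal K A * ‖x‖ ≤ ‖Matrix.toEuclideanLin A x‖ := by
    refine le_of_sq_le_sq ?_ (norm_nonneg _)
    rw [norm_apply_sq_eq_sum_singularValues _ hd, mul_pow, ← v.repr.norm_map x,
      EuclideanSpace.norm_sq_eq, Finset.mul_sum]
    refine Finset.sum_le_sum fun i _ => ?_
    change _ ≤ _ * v.repr x i ^ 2
    rw [Real.norm_eq_abs, sq_abs, hrep]
    split_ifs with hi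
    · gcongr
      · exact singularValues_nonneg _ _
      · exact singularValues_antitone _ (by omega)
    · simp
  have hx0 : 0 < ‖x‖ := by
    rw [norm_pos_iff]
    intro h0
    apply ha0
    ext j
    have := hrep (Fin.castLE hKn j)
    rw [h0] at this
    simpa using this.symm
  exact le_of_mul_le_mul_right (hlow.trans hup) hx0

/-- Weyl's inequality for the leading eigenvalues. -/
theorem IsLeadingEigen.singVal_sub_le {V : Matrix (Fin n) (Fin K) ℝ} {d : Fin K → ℝ}
    (h : IsLeadingEigen A V d) (hA : A.IsSymm) (hP : P.IsSymm) (hl : IsLeadingEigen P U l)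
    (k : Fin K) : singVal K P - ‖A - P‖ ≤ |d k| := by
  -- The test vector `U a` lies in the leading eigenspace of `P`, where `P` expands by at least
  -- `singVal K P`, and is orthogonal to all columns of `V` but the `k`-th.
  obtain ⟨a, ha0, ha⟩ := exists_ne_zero_mulVec_eq_zero_of_ne (Vᵀ * U) k
  have hup := h.norm_mulVec_le_of_orthogonal hA k (x := U *ᵥ a) fun j hj => by
    rw [Matrix.mulVec_mulVec]; exact ha j hj
  have hPU : ‖toLp 2 (P *ᵥ (U *ᵥ a))‖ = ‖toLp 2 (Matrix.diagonal l *ᵥ a)‖ := by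
    rw [Matrix.mulVec_mulVec, hl.eigen, ← Matrix.mulVec_mulVec,
      norm_mulVec_of_transpose_mul_self hl.orthonormal]
  have hlow : singVal K P * ‖toLp 2 a‖ ≤ ‖toLp 2 (Matrix.diagonal l *ᵥ a)‖ := by
    have h0 : 0 ≤ singVal K P := singularValues_nonneg _ _
    refine le_of_sq_le_sq ?_ (norm_nonneg _)
    rw [mul_pow, EuclideanSpace.norm_sq_eq, EuclideanSpace.norm_sq_eq, Finset.mul_sum]
    refine Finset.sum_le_sum fun i _ => ?_
    simp only [Matrix.mulVec_diagonal, norm_mul, mul_pow, Real.norm_eq_abs]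
    gcongr
    exact hl.singVal_le hP i
  have hE := norm_mulVec_le (A - P) (U *ᵥ a)
  have ha1 : 0 < ‖toLp 2 a‖ := by
    rw [norm_pos_iff]
    intro h0
    exact ha0 (congrArg ofLp h0)
  rw [norm_mulVec_of_transpose_mul_self hl.orthonormal] at hup hE
  rw [Matrix.sub_mulVec, toLp_sub] at hE
  have htri := norm_sub_norm_le (toLp 2 (P *ᵥ (U *ᵥ a))) (toLp 2 (A *ᵥ (U *ᵥ a)))
  rw [norm_sub_rev] at htri
  refine le_of_mul_le_mul_right ?_ ha1
  linarith

end LeadingEigen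

/-! ### Successive projection for well-conditioned vertices -/

section SuccessiveProjection

open WithLp

variable {n K : ℕ} {E : Type*} [NormedAddCommGroup E] [InnerProductSpace ℝ E]

/-- The variance identity, a quantitative strict convexity of the squared norm: a combination almost
as long as its longest member has small spread. -/
theorem sum_mul_norm_sq_sub_norm_sum_sq {ι : Type*} [Fintype ι] (θ : ι → ℝ) (hθ : ∑ l, θ l = 1)
    (X : ι → E) :
    ∑ l, θ l * ‖X l‖ ^ 2 - ‖∑ l, θ l • X l‖ ^ 2 =
      1 / 2 * ∑ k, ∑ l, θ k * θ l * ‖X k - X l‖ ^ 2 := by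
  have h1 : ‖∑ l, θ l • X l‖ ^ 2 = ∑ k, ∑ l, θ k * θ l * inner ℝ (X k) (X l) := by
    rw [← real_inner_self_eq_norm_sq, sum_inner]
    refine Finset.sum_congr rfl fun k _ => ?_
    rw [inner_sum]
    refine Finset.sum_congr rfl fun l _ => ?_
    rw [real_inner_smul_left, real_inner_smul_right]
    ring
  have h2 : ∑ k, ∑ l, θ k * θ l * ‖X k‖ ^ 2 = ∑ l, θ l * ‖X l‖ ^ 2 := by
    refine Finset.sum_congr rfl fun k _ => ?_
    rw [← Finset.sum_mul, ← Finset.mul_sum, hθ, mul_one]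
  have h3 : ∑ k, ∑ l, θ k * θ l * ‖X l‖ ^ 2 = ∑ l, θ l * ‖X l‖ ^ 2 := by
    rw [Finset.sum_comm, ← h2]
    refine Finset.sum_congr rfl fun k _ => Finset.sum_congr rfl fun l _ => ?_
    ring
  have h4 : ∑ k, ∑ l, θ k * θ l * ‖X k - X l‖ ^ 2 =
      ∑ k, ∑ l, θ k * θ l * ‖X k‖ ^ 2 - 2 * ∑ k, ∑ l, θ k * θ l * inner ℝ (X k) (X l)
        + ∑ k, ∑ l, θ k * θ l * ‖X l‖ ^ 2 := by
    rw [Finset.mul_sum, ← Finset.sum_sub_distrib, ← Finset.sum_add_distrib]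
    refine Finset.sum_congr rfl fun k _ => ?_
    rw [Finset.mul_sum, ← Finset.sum_sub_distrib, ← Finset.sum_add_distrib]
    refine Finset.sum_congr rfl fun l _ => ?_
    rw [norm_sub_sq_real]
    ring
  rw [h4, h1, h2, h3]
  ring

theorem norm_sum_smul_sub_le {θ : Fin K → ℝ} (hθ0 : ∀ l, 0 ≤ θ l) (hθ1 : ∑ l, θ l = 1)
    {v : Fin K → E} {c : ℝ} (hv : ∀ l, ‖v l‖ ≤ c) (k : Fin K) :
    ‖∑ l, θ l • v l - v k‖ ≤ 2 * c * (1 - θ k) := by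
  have h1 : ∑ l, θ l • v l - v k = ∑ l ∈ Finset.univ.erase k, θ l • (v l - v k) := by
    rw [Finset.sum_erase _ (by simp)]
    simp only [smul_sub, Finset.sum_sub_distrib]
    rw [← Finset.sum_smul, hθ1, one_smul]
  have h2 : ∑ l ∈ Finset.univ.erase k, θ l = 1 - θ k := by
    rw [← hθ1, ← Finset.add_sum_erase _ _ (Finset.mem_univ k)]; ring
  rw [h1, ← h2, Finset.mul_sum]
  refine norm_sum_le_of_le _ fun l _ => ?_
  rw [norm_smul, Real.norm_of_nonneg (hθ0 l), mul_comm]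
  refine mul_le_mul_of_nonneg_right ?_ (hθ0 l)
  have := norm_sub_le (v l) (v k)
  have := hv l
  have := hv k
  linarith

variable [FiniteDimensional ℝ E]

/-- Vectors of a well-conditioned family keep a large distance to the span of perturbations of
other members of the family. -/
theorem norm_le_norm_orthogonal_starProjection {v : Fin K → E} {w : Fin K → E} {f : Fin K → Fin K}
    {s : Finset (Fin K)} {τ : ℝ}
    (hlow : ∀ a : Fin K → ℝ, 1 / 2 * ‖toLp 2 a‖ ≤ ‖∑ l, a l • v l‖)
    (hf : Set.InjOn f s) (hw : ∀ j ∈ s, ‖w j - v (f j)‖ ≤ τ) (hτ : √K * τ ≤ 1 / 4)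
    {b : Fin K → ℝ} (hb : ∀ j ∈ s, b (f j) = 0) :
    1 / 4 * ‖toLp 2 b‖ ≤
      ‖(Submodule.span ℝ (w '' s))ᗮ.starProjection (∑ l, b l • v l)‖ := by
  set X := ∑ l, b l • v l with hX
  set V := Submodule.span ℝ (w '' (s : Set (Fin K))) with hV
  have hz : X - Vᗮ.starProjection X ∈ V := by
    have h := V.starProjection_add_starProjection_orthogonal X
    have h2 : X - Vᗮ.starProjection X = V.starProjection X := by
      rw [sub_eq_iff_eq_add]; exact h.symm
    rw [h2]
    exact V.starProjection_apply_mem X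
  obtain ⟨α, hα⟩ : ∃ α : Fin K → ℝ, ∑ j ∈ s, α j • w j = X - Vᗮ.starProjection X := by
    obtain ⟨α', hα'⟩ := (Submodule.mem_span_image_finset_iff_exists_fun ℝ).1 hz
    refine ⟨fun j => if h : j ∈ s then α' ⟨j, h⟩ else 0, ?_⟩
    rw [← hα', ← Finset.sum_attach]
    exact Finset.sum_congr rfl fun j _ => by simp
  -- Replacing each `w j` by `v (f j)` turns the residual into `∑ a l • v l`. Since `b` vanishes on
  -- `f '' s`, nothing cancels: `‖a‖² = ‖b‖² + ‖α‖²`. The replacement costs at most `√K τ ‖a‖`, half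
  -- of the lower bound `‖a‖ / 2`.
  set a : Fin K → ℝ := fun l => b l - ∑ j ∈ s, if f j = l then α j else 0 with ha
  have haf : ∀ j ∈ s, a (f j) = - α j := by
    intro j hj
    simp only [ha, hb j hj, zero_sub, neg_inj]
    rw [Finset.sum_eq_single j]
    · simp
    · intro i hi hij
      rw [if_neg]
      intro h
      exact hij (hf hi hj h)
    · intro h; exact absurd hj h
  have han : ∀ l, l ∉ s.image f → a l = b l := by
    intro l hl
    simp only [ha]
    rw [Finset.sum_eq_zero, sub_zero]
    intro j hj
    rw [if_neg]
    rintro rfl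
    exact hl (Finset.mem_image_of_mem f hj)
  have hnorm : ‖toLp 2 a‖ ^ 2 = ‖toLp 2 b‖ ^ 2 + ∑ j ∈ s, α j ^ 2 := by
    rw [EuclideanSpace.norm_sq_eq, EuclideanSpace.norm_sq_eq]
    simp only [Real.norm_eq_abs, sq_abs]
    rw [← Finset.sum_add_sum_compl (s.image f) (fun l => a l ^ 2),
      ← Finset.sum_add_sum_compl (s.image f) (fun l => b l ^ 2),
      Finset.sum_image hf, Finset.sum_image hf]
    have h1 : ∑ j ∈ s, a (f j) ^ 2 = ∑ j ∈ s, α j ^ 2 :=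
      Finset.sum_congr rfl fun j hj => by rw [haf j hj, neg_sq]
    have h2 : ∑ j ∈ s, b (f j) ^ 2 = 0 :=
      Finset.sum_eq_zero fun j hj => by rw [hb j hj]; simp
    have h3 : ∑ l ∈ (s.image f)ᶜ, a l ^ 2 = ∑ l ∈ (s.image f)ᶜ, b l ^ 2 :=
      Finset.sum_congr rfl fun l hl => by rw [han l (Finset.mem_compl.1 hl)]
    rw [h1, h2, h3]
    ring
  have hdec : Vᗮ.starProjection X = ∑ l, a l • v l - ∑ j ∈ s, α j • (w j - v (f j)) := by
    have h1 : ∑ l, a l • v l = X - ∑ j ∈ s, α j • v (f j) := by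
      simp only [ha, sub_smul, Finset.sum_sub_distrib, hX, Finset.sum_smul]
      rw [Finset.sum_comm]
      simp
    simp only [smul_sub, Finset.sum_sub_distrib]
    rw [h1, hα]
    abel
  have hsum : ‖∑ j ∈ s, α j • (w j - v (f j))‖ ≤ 1 / 4 * ‖toLp 2 a‖ := by
    by_cases hs : s = ∅
    · simp [hs]
    obtain ⟨j₀, hj₀⟩ := Finset.nonempty_iff_ne_empty.2 hs
    have hτ0 : 0 ≤ τ := (norm_nonneg _).trans (hw j₀ hj₀)
    have hc : (∑ j ∈ s, |α j|) ≤ √K * ‖toLp 2 a‖ := by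
      refine le_of_sq_le_sq ?_ (by positivity)
      rw [mul_pow, Real.sq_sqrt (by positivity), hnorm]
      calc (∑ j ∈ s, |α j|) ^ 2 ≤ s.card * ∑ j ∈ s, |α j| ^ 2 := sq_sum_le_card_mul_sum_sq
        _ ≤ K * ∑ j ∈ s, |α j| ^ 2 := by
            gcongr
            simpa using s.card_le_univ
        _ ≤ K * (‖toLp 2 b‖ ^ 2 + ∑ j ∈ s, α j ^ 2) := by
            simp only [sq_abs]
            gcongr
            exact le_add_of_nonneg_left (by positivity)
    calc ‖∑ j ∈ s, α j • (w j - v (f j))‖ ≤ ∑ j ∈ s, |α j| * τ := by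
          refine norm_sum_le_of_le _ fun j hj => ?_
          rw [norm_smul, Real.norm_eq_abs]
          gcongr
          exact hw j hj
      _ = (∑ j ∈ s, |α j|) * τ := by rw [Finset.sum_mul]
      _ ≤ √K * ‖toLp 2 a‖ * τ := by gcongr
      _ = √K * τ * ‖toLp 2 a‖ := by ring
      _ ≤ _ := by gcongr
  have hab : ‖toLp 2 b‖ ≤ ‖toLp 2 a‖ := by
    refine le_of_sq_le_sq ?_ (norm_nonneg _)
    rw [hnorm]
    exact le_add_of_nonneg_right (by positivity)
  have h5 := hlow a
  have h6 := norm_sub_norm_le (∑ l, a l • v l) (∑ j ∈ s, α j • (w j - v (f j)))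
  rw [hdec]
  linarith

/-- One step of the successive projection algorithm for a near-separable configuration of points:
the selected point is close to a vertex not selected before. -/
theorem exists_vertex_of_max_residual {θ : Fin n → Fin K → ℝ} (hθ0 : ∀ i l, 0 ≤ θ i l)
    (hθ1 : ∀ i, ∑ l, θ i l = 1) {v : Fin K → E} {g ρ : Fin n → E} {η : ℝ}
    (hlow : ∀ a : Fin K → ℝ, 1 / 2 * ‖toLp 2 a‖ ≤ ‖∑ l, a l • v l‖)
    (hv : ∀ l, ‖v l‖ ≤ 2) (hg : ∀ i, g i = ∑ l, θ i l • v l + ρ i)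
    (hρ : ∀ i, ‖ρ i‖ ≤ 2 * η) {p : Fin K → Fin n} (hp : ∀ l, g (p l) = v l)
    (hη : √K * η ≤ 1 / 6000) {s : Finset (Fin K)} (hs : s.card < K)
    {sel : Fin K → Fin n} {f : Fin K → Fin K} (hf : Set.InjOn f s)
    (hsel : ∀ j ∈ s, 1 - 160 * η ≤ θ (sel j) (f j)) {i₀ : Fin n}
    (hmax : ∀ i, ‖(Submodule.span ℝ ((fun j => g (sel j)) '' s))ᗮ.starProjection (g i)‖
      ≤ ‖(Submodule.span ℝ ((fun j => g (sel j)) '' s))ᗮ.starProjection (g i₀)‖) :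
    ∃ l, l ∉ s.image f ∧ 1 - 160 * η ≤ θ i₀ l := by
  have hη0 : 0 ≤ η := by have := (norm_nonneg _).trans (hρ i₀); linarith
  have hK1 : 1 ≤ √(K : ℝ) := by
    rw [Real.one_le_sqrt]; exact_mod_cast (by omega : 1 ≤ K)
  have hη1 : η ≤ 1 / 6000 := by nlinarith
  set V := Submodule.span ℝ ((fun j => g (sel j)) '' (s : Set (Fin K))) with hV
  set pr := Vᗮ.starProjection with hpr
  have hprn : ∀ x, ‖pr x‖ ≤ ‖x‖ := fun x => Submodule.norm_starProjection_apply_le _ x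
  -- Here `642 = 2 * 2 * 160 + 2`: the missing weight, then the noise.
  have hτ : ∀ j ∈ s, ‖g (sel j) - v (f j)‖ ≤ 642 * η := by
    intro j hj
    have h1 := norm_sum_smul_sub_le (hθ0 (sel j)) (hθ1 (sel j)) hv (f j)
    have h2 := hsel j hj
    have h3 := hρ (sel j)
    rw [hg, add_sub_right_comm]
    refine (norm_add_le _ _).trans ?_
    linarith
  have hdist : ∀ b : Fin K → ℝ, (∀ j ∈ s, b (f j) = 0) →
      1 / 4 * ‖toLp 2 b‖ ≤ ‖pr (∑ l, b l • v l)‖ := fun b hb =>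
    norm_le_norm_orthogonal_starProjection hlow hf hτ (by linarith) hb
  set T : Finset (Fin K) := (s.image f)ᶜ with hT
  have hTmem : ∀ l, l ∈ T ↔ l ∉ s.image f := fun l => Finset.mem_compl
  have hTf : ∀ l ∈ T, ∀ j ∈ s, f j ≠ l := by
    rintro l hl j hj rfl
    exact (hTmem _).1 hl (Finset.mem_image_of_mem f hj)
  have hTne : T.Nonempty := by
    rw [← Finset.card_pos, hT, Finset.card_compl, Fintype.card_fin]
    have := Finset.card_image_le (s := s) (f := f)
    omega
  set X : Fin K → E := fun l => pr (v l) with hX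
  obtain ⟨l₀, hl₀, hl₀max⟩ := T.exists_max_image (fun l => ‖X l‖) hTne
  set w := ‖X l₀‖ with hw
  have hw2 : w ≤ 2 := (hprn _).trans (hv _)
  have hw4 : 1 / 4 ≤ w := by
    have h := hdist (Pi.single l₀ 1) fun j hj => by
      rw [Pi.single_apply, if_neg (hTf l₀ hl₀ j hj)]
    have h1 : ‖toLp 2 (Pi.single l₀ (1 : ℝ) : Fin K → ℝ)‖ = 1 :=
      (PiLp.norm_single 2 (fun _ : Fin K => ℝ) l₀ (1 : ℝ)).trans (by simp)
    rw [h1] at h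
    simpa [Pi.single_apply, hX, hw] using h
  have hXs : ∀ l, l ∉ T → ‖X l‖ ≤ 642 * η := by
    intro l hl
    rw [hTmem, not_not] at hl
    obtain ⟨j, hj, rfl⟩ := Finset.mem_image.1 hl
    have h0 : pr (g (sel j)) = 0 := by
      rw [hpr, Submodule.starProjection_apply_eq_zero_iff, Submodule.orthogonal_orthogonal]
      exact Submodule.subset_span ⟨j, hj, rfl⟩
    have h1 : X (f j) = - pr (g (sel j) - v (f j)) := by
      rw [map_sub, h0]; simp [hX]
    rw [h1, norm_neg]
    exact (hprn _).trans (hτ j hj)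
  set t := θ i₀ with ht
  have ht0 : ∀ l, 0 ≤ t l := hθ0 i₀
  have ht1 : ∑ l, t l = 1 := hθ1 i₀
  set Y := ∑ l, t l • X l with hY
  have hYw : w ≤ ‖Y‖ + 2 * η := by
    have h1 := hmax (p l₀)
    rw [hp] at h1
    have h2 : pr (g i₀) = Y + pr (ρ i₀) := by
      rw [hg, map_add, map_sum]
      simp [hY, hX, ht]
    change w ≤ ‖pr (g i₀)‖ at h1
    rw [h2] at h1
    have := norm_add_le Y (pr (ρ i₀))
    have := hprn (ρ i₀)
    have := hρ i₀
    linarith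
  set σ := ∑ l ∈ Tᶜ, t l with hσ
  have hσ0 : 0 ≤ σ := Finset.sum_nonneg fun l _ => ht0 l
  have hTσ : ∑ l ∈ T, t l = 1 - σ := by
    rw [← ht1, ← Finset.sum_add_sum_compl T]; ring
  -- Weight on used vertices, whose residuals nearly vanish, shortens `Y`: `σ (w - 642 η) ≤ 2 η`,
  -- while `w ≥ 1 / 4`.
  have hσ1 : σ ≤ 16 * η := by
    have h1 : ‖Y‖ ≤ (1 - σ) * w + σ * (642 * η) := by
      rw [hY, ← hTσ, hσ, Finset.sum_mul, Finset.sum_mul, ← Finset.sum_add_sum_compl T]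
      refine (norm_add_le _ _).trans (add_le_add ?_ ?_)
      · refine norm_sum_le_of_le _ fun l hl => ?_
        rw [norm_smul, Real.norm_of_nonneg (ht0 l)]
        exact mul_le_mul_of_nonneg_left (hl₀max l hl) (ht0 l)
      · refine norm_sum_le_of_le _ fun l hl => ?_
        rw [norm_smul, Real.norm_of_nonneg (ht0 l)]
        exact mul_le_mul_of_nonneg_left (hXs l (Finset.mem_compl.1 hl)) (ht0 l)
    nlinarith
  -- The deficit is at most `w² - (w - 2 η)² ≤ 8 η`, and the identity doubles it.
  have hvar : ∑ k, ∑ l, t k * t l * ‖X k - X l‖ ^ 2 ≤ 16 * η := by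
    have h1 := sum_mul_norm_sq_sub_norm_sum_sq t ht1 X
    have h2 : ∑ l, t l * ‖X l‖ ^ 2 ≤ w ^ 2 := by
      calc ∑ l, t l * ‖X l‖ ^ 2 ≤ ∑ l, t l * w ^ 2 := by
            refine Finset.sum_le_sum fun l _ => mul_le_mul_of_nonneg_left ?_ (ht0 l)
            refine pow_le_pow_left₀ (norm_nonneg _) ?_ 2
            by_cases hl : l ∈ T
            · exact hl₀max l hl
            · have := hXs l hl
              linarith
        _ = w ^ 2 := by rw [← Finset.sum_mul, ht1, one_mul]
    have h3 : (w - 2 * η) ^ 2 ≤ ‖Y‖ ^ 2 := pow_le_pow_left₀ (by linarith) (by linarith) 2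
    nlinarith
  -- Residuals of distinct unused vertices stay apart, at squared distance at least `2 / 16`; hence
  -- the factor `8`.
  have hpair : ∀ k ∈ T, ∀ l ∈ T, t k * t l - (if k = l then t k * t l else 0)
      ≤ 8 * (t k * t l * ‖X k - X l‖ ^ 2) := by
    intro k hk l hl
    have hkl := mul_nonneg (ht0 k) (ht0 l)
    split_ifs with h
    · rw [sub_self]; positivity
    · have h1 := hdist (Pi.single k 1 - Pi.single l 1) fun j hj => by
        simp [hTf k hk j hj, hTf l hl j hj]
      have h2 : ‖toLp 2 (Pi.single k (1 : ℝ) - Pi.single l 1 : Fin K → ℝ)‖ ^ 2 = 2 := by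
        rw [norm_toLp_sq]
        simp [h, Ne.symm h]
        norm_num
      have h3 : ∑ i, (Pi.single k (1 : ℝ) - Pi.single l 1 : Fin K → ℝ) i • v i = v k - v l := by
        simp [sub_smul, Finset.sum_sub_distrib, Pi.single_apply]
      rw [h3, map_sub] at h1
      have h4 := pow_le_pow_left₀ (by positivity) h1 2
      rw [mul_pow, h2] at h4
      change _ ≤ ‖X k - X l‖ ^ 2 at h4
      nlinarith
  have hoff : (1 - σ) ^ 2 - ∑ k ∈ T, t k ^ 2 ≤ 128 * η := by
    have h1 : (1 - σ) ^ 2 - ∑ k ∈ T, t k ^ 2 =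
        ∑ k ∈ T, ∑ l ∈ T, (t k * t l - (if k = l then t k * t l else 0)) := by
      simp only [Finset.sum_sub_distrib]
      rw [← hTσ, sq, Finset.sum_mul_sum]
      congr 1
      refine Finset.sum_congr rfl fun k hk => ?_
      simp [hk, sq]
    have h2 : ∑ k ∈ T, ∑ l ∈ T, (t k * t l * ‖X k - X l‖ ^ 2) ≤
        ∑ k, ∑ l, t k * t l * ‖X k - X l‖ ^ 2 := by
      have hnn : ∀ k l, 0 ≤ t k * t l * ‖X k - X l‖ ^ 2 := fun k l =>
        mul_nonneg (mul_nonneg (ht0 k) (ht0 l)) (by positivity)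
      refine (Finset.sum_le_sum fun k _ => Finset.sum_le_sum_of_subset_of_nonneg
        (Finset.subset_univ T) fun l _ _ => hnn k l).trans ?_
      exact Finset.sum_le_sum_of_subset_of_nonneg (Finset.subset_univ T)
        fun k _ _ => Finset.sum_nonneg fun l _ => hnn k l
    rw [h1]
    calc _ ≤ ∑ k ∈ T, ∑ l ∈ T, 8 * (t k * t l * ‖X k - X l‖ ^ 2) :=
          Finset.sum_le_sum fun k hk => Finset.sum_le_sum fun l hl => hpair k hk l hl
      _ = 8 * ∑ k ∈ T, ∑ l ∈ T, (t k * t l * ‖X k - X l‖ ^ 2) := by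
          simp only [Finset.mul_sum]
      _ ≤ _ := by linarith
  obtain ⟨m, hm, hmmax⟩ := T.exists_max_image t hTne
  refine ⟨m, (hTmem m).1 hm, ?_⟩
  -- With `hoff`, the largest weight is at least `(1 - σ) - 128 η / (1 - σ)`, so the loss is linear
  -- in `η`.
  have h1 : ∑ k ∈ T, t k ^ 2 ≤ t m * (1 - σ) := by
    rw [← hTσ, Finset.mul_sum]
    refine Finset.sum_le_sum fun k hk => ?_
    rw [sq]
    exact mul_le_mul_of_nonneg_right (hmmax k hk) (ht0 k)
  have h2 := ht0 m
  change _ ≤ t m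
  nlinarith

/-- The successive projection algorithm finds all vertices of a well-conditioned near-separable
configuration of points. -/
theorem IsSPAChoice.exists_perm {θ : Fin n → Fin K → ℝ} (hθ0 : ∀ i l, 0 ≤ θ i l)
    (hθ1 : ∀ i, ∑ l, θ i l = 1) {v : Fin K → E} {g ρ : Fin n → E} {η : ℝ}
    (hlow : ∀ a : Fin K → ℝ, 1 / 2 * ‖toLp 2 a‖ ≤ ‖∑ l, a l • v l‖)
    (hv : ∀ l, ‖v l‖ ≤ 2) (hg : ∀ i, g i = ∑ l, θ i l • v l + ρ i)
    (hρ : ∀ i, ‖ρ i‖ ≤ 2 * η) {p : Fin K → Fin n} (hp : ∀ l, g (p l) = v l)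
    (hη : √K * η ≤ 1 / 6000) {J : Fin K → Fin n} (hJ : IsSPAChoice g J) :
    ∃ σ : Equiv.Perm (Fin K), ∀ k, 1 - 160 * η ≤ θ (J k) (σ k) := by
  -- The second clause records that the vertex is new, since `160 η < 1 / 2`; it makes the choice of
  -- vertices injective.
  have main : ∀ k : Fin K, ∃ l, 1 - 160 * η ≤ θ (J k) l ∧ ∀ j < k, θ (J j) l < 1 / 2 := by
    intro k
    have hη1 : η ≤ 1 / 6000 := by
      have hη0 : 0 ≤ η := by have := (norm_nonneg _).trans (hρ (J k)); linarith
      have hK1 : 1 ≤ √(K : ℝ) := by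
        rw [Real.one_le_sqrt]; exact_mod_cast k.pos
      nlinarith
    induction k using WellFoundedLT.induction with
    | _ k ih =>
      have ih' : ∀ j : Fin K, ∃ l, j < k →
          (1 - 160 * η ≤ θ (J j) l ∧ ∀ i < j, θ (J i) l < 1 / 2) := by
        intro j
        by_cases hj : j < k
        · obtain ⟨l, hl⟩ := ih j hj
          exact ⟨l, fun _ => hl⟩
        -- An arbitrary value at indices not yet treated.
        · exact ⟨k, fun h => absurd h hj⟩
      choose f hf using ih'
      have hlt : ∀ i j, i < j → j < k → f i ≠ f j := by
        intro i j hij hj h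
        have h1 := (hf i (hij.trans hj)).1
        have h2 := (hf j hj).2 i hij
        rw [h] at h1
        linarith
      obtain ⟨l, hl, hl'⟩ := exists_vertex_of_max_residual hθ0 hθ1 hlow hv hg hρ hp hη
        (s := Finset.Iio k) (sel := J) (f := f) (i₀ := J k) (by simp) (by
          intro i hi j hj h
          rw [Finset.coe_Iio, Set.mem_Iio] at hi hj
          rcases lt_trichotomy i j with hij | hij | hij
          · exact absurd h (hlt i j hij hj)
          · exact hij
          · exact absurd h.symm (hlt j i hij hi))
        (fun j hj => (hf j (Finset.mem_Iio.1 hj)).1)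
        (by rw [Finset.coe_Iio]; exact hJ k)
      refine ⟨l, hl', fun j hj => ?_⟩
      have hne : f j ≠ l := by
        rintro rfl
        exact hl (Finset.mem_image_of_mem f (Finset.mem_Iio.2 hj))
      have h1 := (hf j hj).1
      have h2 : θ (J j) (f j) + θ (J j) l ≤ ∑ i, θ (J j) i := by
        rw [← Finset.sum_pair hne]
        exact Finset.sum_le_sum_of_subset_of_nonneg (Finset.subset_univ _) fun i _ _ => hθ0 _ _
      rw [hθ1] at h2
      linarith
  choose f hf using main
  have hinj : Function.Injective f := by
    have hlt : ∀ i j, i < j → f i ≠ f j := by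
      intro i j hij h
      have hη1 : η ≤ 1 / 6000 := by
        have hη0 : 0 ≤ η := by have := (norm_nonneg _).trans (hρ (J i)); linarith
        have hK1 : 1 ≤ √(K : ℝ) := by
          rw [Real.one_le_sqrt]; exact_mod_cast i.pos
        nlinarith
      have h1 := (hf i).1
      have h2 := (hf j).2 i hij
      rw [h] at h1
      linarith
    intro i j h
    rcases lt_trichotomy i j with hij | hij | hij
    · exact absurd h (hlt i j hij)
    · exact hij
    · exact absurd h.symm (hlt j i hij)
  exact ⟨Equiv.ofBijective f (Finite.injective_iff_bijective.1 hinj), fun k => (hf k).1⟩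

end SuccessiveProjection

/-! ### Quadratic forms: inverses, trace and determinant -/

section QuadraticForms

open WithLp

variable {n K : ℕ}

theorem abs_dotProduct_le (x y : Fin K → ℝ) : |x ⬝ᵥ y| ≤ ‖toLp 2 x‖ * ‖toLp 2 y‖ := by
  have h : x ⬝ᵥ y = inner ℝ (toLp 2 y) (toLp 2 x) := by
    simp [dotProduct, PiLp.inner_apply]
  rw [h, mul_comm]
  exact abs_real_inner_le_norm _ _

theorem dotProduct_mulVec_comm {M : Matrix (Fin K) (Fin K) ℝ} (hM : M.IsSymm) (x y : Fin K → ℝ) :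
    x ⬝ᵥ (M *ᵥ y) = y ⬝ᵥ (M *ᵥ x) := by
  rw [Matrix.dotProduct_mulVec, ← Matrix.mulVec_transpose, hM.eq, dotProduct_comm]

/-- Bounds for a quadratic form pass to the inverse matrix. -/
theorem inv_quadForm_bounds {S : Matrix (Fin K) (Fin K) ℝ} (hS : S.IsSymm) (hdet : S.det ≠ 0)
    {a b : ℝ} (ha : 0 < a) (hb : 0 < b)
    (hlow : ∀ x, a * ‖toLp 2 x‖ ^ 2 ≤ x ⬝ᵥ (S *ᵥ x))
    (hup : ∀ x, x ⬝ᵥ (S *ᵥ x) ≤ b * ‖toLp 2 x‖ ^ 2) (x : Fin K → ℝ) :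
    a * ‖toLp 2 (S⁻¹ *ᵥ x)‖ ≤ ‖toLp 2 x‖ ∧ ‖toLp 2 x‖ ^ 2 ≤ b * (x ⬝ᵥ (S⁻¹ *ᵥ x)) ∧
      a * (x ⬝ᵥ (S⁻¹ *ᵥ x)) ≤ ‖toLp 2 x‖ ^ 2 := by
  set z := S⁻¹ *ᵥ x with hz
  have hSz : S *ᵥ z = x := by
    rw [hz, Matrix.mulVec_mulVec, Matrix.mul_nonsing_inv _ (isUnit_iff_ne_zero.2 hdet),
      Matrix.one_mulVec]
  have h1 : a * ‖toLp 2 z‖ ≤ ‖toLp 2 x‖ := by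
    have h := hlow z
    rw [hSz] at h
    have h2 := (le_abs_self _).trans (abs_dotProduct_le z x)
    rcases (norm_nonneg (toLp 2 z)).eq_or_lt with h0 | h0
    · rw [← h0]; simp
    · refine le_of_mul_le_mul_right ?_ h0
      nlinarith
  refine ⟨h1, ?_, ?_⟩
  -- Completing the square: the form of `S` is nonnegative at `S⁻¹ x - b⁻¹ x`.
  · have h := hlow (z - b⁻¹ • x)
    have h2 := hup x
    have hnn : 0 ≤ a * ‖toLp 2 (z - b⁻¹ • x)‖ ^ 2 := by positivity
    have h3 : (z - b⁻¹ • x) ⬝ᵥ (S *ᵥ (z - b⁻¹ • x)) =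
        x ⬝ᵥ z - 2 * b⁻¹ * ‖toLp 2 x‖ ^ 2 + b⁻¹ ^ 2 * (x ⬝ᵥ (S *ᵥ x)) := by
      have h4 : z ⬝ᵥ (S *ᵥ x) = x ⬝ᵥ x := by rw [dotProduct_mulVec_comm hS, hSz]
      rw [Matrix.mulVec_sub, Matrix.mulVec_smul, hSz, sub_dotProduct, dotProduct_sub,
        dotProduct_sub, smul_dotProduct, smul_dotProduct, dotProduct_smul, dotProduct_smul, h4,
        norm_toLp_sq, dotProduct_comm z x]
      simp only [smul_eq_mul]
      ring
    have h5 : b⁻¹ ^ 2 * (x ⬝ᵥ (S *ᵥ x)) ≤ b⁻¹ * ‖toLp 2 x‖ ^ 2 := by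
      calc b⁻¹ ^ 2 * (x ⬝ᵥ (S *ᵥ x)) ≤ b⁻¹ ^ 2 * (b * ‖toLp 2 x‖ ^ 2) := by gcongr
        _ = _ := by field_simp
    have h6 : b⁻¹ * ‖toLp 2 x‖ ^ 2 ≤ x ⬝ᵥ z := by linarith
    calc ‖toLp 2 x‖ ^ 2 = b * (b⁻¹ * ‖toLp 2 x‖ ^ 2) := by field_simp
      _ ≤ _ := by gcongr
  · have h2 := (le_abs_self _).trans (abs_dotProduct_le x z)
    have h3 := norm_nonneg (toLp 2 x)
    nlinarith

theorem sum_mul_quadForm_sub {ι : Type*} [Fintype ι] {M : Matrix (Fin K) (Fin K) ℝ}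
    (hM : M.IsSymm) {q : ι → ℝ} (hq : ∑ j, q j = 1) (y : ι → Fin K → ℝ) (c : Fin K → ℝ) :
    ∑ j, q j * ((y j - c) ⬝ᵥ (M *ᵥ (y j - c))) =
      ∑ j, q j * (y j ⬝ᵥ (M *ᵥ y j)) - 2 * (c ⬝ᵥ (M *ᵥ ∑ j, q j • y j)) + c ⬝ᵥ (M *ᵥ c) := by
  have h1 : c ⬝ᵥ (M *ᵥ ∑ j, q j • y j) = ∑ j, q j * (c ⬝ᵥ (M *ᵥ y j)) := by
    rw [Matrix.mulVec_sum, dotProduct_sum]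
    simp [Matrix.mulVec_smul]
  have h2 : c ⬝ᵥ (M *ᵥ c) = ∑ j, q j * (c ⬝ᵥ (M *ᵥ c)) := by rw [← Finset.sum_mul, hq, one_mul]
  rw [h1, h2, Finset.mul_sum, ← Finset.sum_sub_distrib, ← Finset.sum_add_distrib]
  refine Finset.sum_congr rfl fun j _ => ?_
  rw [Matrix.mulVec_sub, sub_dotProduct, dotProduct_sub, dotProduct_sub,
    dotProduct_mulVec_comm hM (y j) c]
  ring

/-- A lower bound for a square matrix is an upper bound for the norm of its inverse, and norms are
invariant under transposition. -/
theorem lower_bound_transpose {M : Matrix (Fin K) (Fin K) ℝ} (hM : M.det ≠ 0) {c : ℝ} (hc : 0 < c)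
    (h : ∀ x, c * ‖toLp 2 x‖ ≤ ‖toLp 2 (M *ᵥ x)‖) (x : Fin K → ℝ) :
    c * ‖toLp 2 x‖ ≤ ‖toLp 2 (Mᵀ *ᵥ x)‖ := by
  have hu := isUnit_iff_ne_zero.2 hM
  have h1 : ‖M⁻¹‖ ≤ c⁻¹ := by
    refine opNorm_le_of_mulVec (by positivity) fun z => ?_
    have := h (M⁻¹ *ᵥ z)
    rw [Matrix.mulVec_mulVec, Matrix.mul_nonsing_inv _ hu, Matrix.one_mulVec] at this
    rw [inv_mul_eq_div, le_div_iff₀ hc, mul_comm]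
    exact this
  rw [← norm_transpose_eq] at h1
  have h2 := norm_mulVec_le (M⁻¹)ᵀ (Mᵀ *ᵥ x)
  rw [Matrix.mulVec_mulVec, ← Matrix.transpose_mul, Matrix.mul_nonsing_inv _ hu,
    Matrix.transpose_one, Matrix.one_mulVec] at h2
  have h3 : ‖toLp 2 x‖ ≤ c⁻¹ * ‖toLp 2 (Mᵀ *ᵥ x)‖ :=
    h2.trans (mul_le_mul_of_nonneg_right h1 (norm_nonneg _))
  rwa [inv_mul_eq_div, le_div_iff₀ hc, mul_comm] at h3

theorem quadForm_eq_sum_eigenvalues {X : Matrix (Fin K) (Fin K) ℝ} (hX : X.IsHermitian)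
    (x : Fin K → ℝ) :
    x ⬝ᵥ (X *ᵥ x) = ∑ i, hX.eigenvalues i * hX.eigenvectorBasis.repr (toLp 2 x) i ^ 2 := by
  have h1 : x ⬝ᵥ (X *ᵥ x) = inner ℝ (toLp 2 x) (toLp 2 (X *ᵥ x)) := by
    simp [dotProduct, PiLp.inner_apply, mul_comm]
  rw [h1, ← hX.eigenvectorBasis.repr.inner_map_map, PiLp.inner_apply]
  refine Finset.sum_congr rfl fun i _ => ?_
  have h2 : hX.eigenvectorBasis.repr (toLp 2 (X *ᵥ x)) i =
      hX.eigenvalues i * hX.eigenvectorBasis.repr (toLp 2 x) i := by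
    have hsymm : X.IsSymm := by
      rw [Matrix.IsSymm, ← Matrix.conjTranspose_eq_transpose_of_trivial]; exact hX
    rw [OrthonormalBasis.repr_apply_apply, OrthonormalBasis.repr_apply_apply]
    have h3 : ∀ u v : EuclideanSpace ℝ (Fin K), inner ℝ u v = ofLp u ⬝ᵥ ofLp v := by
      intro u v
      simp [dotProduct, PiLp.inner_apply, mul_comm]
    rw [h3, h3]
    change ofLp (hX.eigenvectorBasis i) ⬝ᵥ (X *ᵥ x) = _ * (_ ⬝ᵥ x)
    rw [dotProduct_mulVec_comm hsymm, hX.mulVec_eigenvectorBasis, dotProduct_smul, smul_eq_mul,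
      dotProduct_comm]
  rw [h2]
  simp
  ring

/-- A positive definite matrix whose trace and determinant are almost those of the identity
matrix is well-conditioned. -/
theorem quadForm_bounds_of_trace_of_det {X : Matrix (Fin K) (Fin K) ℝ} (hX : X.PosDef)
    (htr : X.trace ≤ K) (hdet : Real.exp (-(1 / 50)) ≤ X.det) (x : Fin K → ℝ) :
    1 / 2 * ‖toLp 2 x‖ ^ 2 ≤ x ⬝ᵥ (X *ᵥ x) ∧ x ⬝ᵥ (X *ᵥ x) ≤ 2 * ‖toLp 2 x‖ ^ 2 := by
  set ν := hX.1.eigenvalues with hν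
  have hpos : ∀ i, 0 < ν i := hX.eigenvalues_pos
  have h1 : ∑ i, ν i ≤ K := by
    have := hX.1.trace_eq_sum_eigenvalues
    simp only [RCLike.ofReal_real_eq_id, id] at this
    rw [this] at htr
    exact htr
  have h2 : -(1 / 50) ≤ ∑ i, Real.log (ν i) := by
    have := hX.1.det_eq_prod_eigenvalues
    simp only [RCLike.ofReal_real_eq_id, id] at this
    rw [this] at hdet
    rw [← Real.log_prod fun i _ => (hpos i).ne']
    rwa [Real.le_log_iff_exp_le (Finset.prod_pos fun i _ => hpos i)]
  -- These AM-GM deficits are nonnegative with sum `tr X - K - log det X ≤ 1 / 50`, so each is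
  -- small. The tangents to `log` at `2` and `1 / 2` then confine `ν i`.
  have h3 : ∀ i, ν i - 1 - Real.log (ν i) ≤ 1 / 50 := by
    intro i
    have hnn : ∀ j ∈ Finset.univ, 0 ≤ ν j - 1 - Real.log (ν j) := fun j _ => by
      have := Real.log_le_sub_one_of_pos (hpos j); linarith
    refine (Finset.single_le_sum hnn (Finset.mem_univ i)).trans ?_
    rw [Finset.sum_sub_distrib, Finset.sum_sub_distrib]
    simp only [Finset.sum_const, Finset.card_univ, Fintype.card_fin, nsmul_eq_mul, mul_one]
    linarith
  have hlog2 := Real.log_two_lt_d9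
  have hlog2' := Real.log_two_gt_d9
  have h4 : ∀ i, ν i ≤ 2 := by
    intro i
    by_contra! hlt
    have h5 := Real.log_le_sub_one_of_pos (div_pos (hpos i) two_pos)
    rw [Real.log_div (hpos i).ne' two_ne_zero] at h5
    linarith [h3 i]
  have h5 : ∀ i, 1 / 2 ≤ ν i := by
    intro i
    by_contra! hlt
    have h5 := Real.log_le_sub_one_of_pos (mul_pos (hpos i) two_pos)
    rw [Real.log_mul (hpos i).ne' two_ne_zero] at h5
    linarith [h3 i]
  rw [quadForm_eq_sum_eigenvalues hX.1, ← hX.1.eigenvectorBasis.repr.norm_map (toLp 2 x),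
    EuclideanSpace.norm_sq_eq, Finset.mul_sum, Finset.mul_sum]
  simp only [Real.norm_eq_abs, sq_abs]
  exact ⟨Finset.sum_le_sum fun i _ => mul_le_mul_of_nonneg_right (h5 i) (sq_nonneg _),
    Finset.sum_le_sum fun i _ => mul_le_mul_of_nonneg_right (h4 i) (sq_nonneg _)⟩

end QuadraticForms

/-! ### Second moment matrices of clustered points -/

section Design

open WithLp

variable {n K : ℕ}

/-- The second moment matrix of points `y i` that are grouped in `K` clusters, with weight `u k i`
for the point `y i` as a member of the `k`-th cluster. -/
def designMatrix (y : Fin n → Fin K → ℝ) (u : Fin K → Fin n → ℝ) : Matrix (Fin K) (Fin K) ℝ :=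
  ∑ k, ∑ i, u k i • Matrix.vecMulVec (y i) (y i)

theorem designMatrix_isSymm (y : Fin n → Fin K → ℝ) (u : Fin K → Fin n → ℝ) :
    (designMatrix y u).IsSymm := by
  rw [Matrix.IsSymm, designMatrix, Matrix.transpose_sum]
  refine Finset.sum_congr rfl fun k _ => ?_
  rw [Matrix.transpose_sum]
  refine Finset.sum_congr rfl fun i _ => ?_
  rw [Matrix.transpose_smul, Matrix.transpose_vecMulVec]

theorem quadForm_designMatrix (y : Fin n → Fin K → ℝ) (u : Fin K → Fin n → ℝ) (x : Fin K → ℝ) :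
    x ⬝ᵥ (designMatrix y u *ᵥ x) = ∑ k, ∑ i, u k i * (x ⬝ᵥ y i) ^ 2 := by
  rw [designMatrix, Matrix.sum_mulVec, dotProduct_sum]
  refine Finset.sum_congr rfl fun k _ => ?_
  rw [Matrix.sum_mulVec, dotProduct_sum]
  refine Finset.sum_congr rfl fun i _ => ?_
  rw [Matrix.smul_mulVec, Matrix.vecMulVec_mulVec, dotProduct_smul, dotProduct_comm (y i) x]
  simp [sq]

theorem trace_mul_vecMulVec_self (M : Matrix (Fin K) (Fin K) ℝ) (y : Fin K → ℝ) :
    (M * Matrix.vecMulVec y y).trace = y ⬝ᵥ (M *ᵥ y) := by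
  rw [Matrix.mul_vecMulVec, Matrix.trace_vecMulVec, dotProduct_comm]

/-- With all points at the vertices the form is `‖x‖²`. Displacements by `τ` create squared errors
of at most `τ² ‖x‖²` per cluster, so only `K τ²` has to be small. -/
theorem designMatrix_quadForm_bounds {y : Fin n → Fin K → ℝ} {u : Fin K → Fin n → ℝ} {τ : ℝ}
    (hu0 : ∀ k i, 0 ≤ u k i) (hu1 : ∀ k, ∑ i, u k i = 1)
    (hclose : ∀ k i, u k i ≠ 0 → ‖toLp 2 (y i - Pi.single k 1)‖ ≤ τ)
    (hτ : K * τ ^ 2 ≤ 1 / 100) (x : Fin K → ℝ) :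
    4 / 5 * ‖toLp 2 x‖ ^ 2 ≤ x ⬝ᵥ (designMatrix y u *ᵥ x) ∧
      x ⬝ᵥ (designMatrix y u *ᵥ x) ≤ 5 / 4 * ‖toLp 2 x‖ ^ 2 := by
  have hx : ‖toLp 2 x‖ ^ 2 = ∑ k, ∑ i, u k i * x k ^ 2 := by
    rw [norm_toLp_sq, dotProduct]
    refine Finset.sum_congr rfl fun k _ => ?_
    rw [← Finset.sum_mul, hu1, one_mul, sq]
  have he : ∀ c : ℝ, ∑ k, ∑ i, u k i * (c * (τ ^ 2 * ‖toLp 2 x‖ ^ 2)) =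
      c * (K * τ ^ 2) * ‖toLp 2 x‖ ^ 2 := by
    intro c
    simp only [← Finset.sum_mul, hu1]
    simp
    ring
  have hdot : ∀ k i, u k i ≠ 0 → ∃ e, x ⬝ᵥ y i = x k + e ∧ e ^ 2 ≤ τ ^ 2 * ‖toLp 2 x‖ ^ 2 := by
    intro k i h
    refine ⟨x ⬝ᵥ (y i - Pi.single k 1), ?_, ?_⟩
    · rw [dotProduct_sub, dotProduct_single, mul_one]; ring
    · rw [← mul_pow, ← sq_abs]
      refine pow_le_pow_left₀ (abs_nonneg _) ((abs_dotProduct_le _ _).trans ?_) 2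
      rw [mul_comm]
      exact mul_le_mul_of_nonneg_right (hclose k i h) (norm_nonneg _)
  have hsq : 0 ≤ ‖toLp 2 x‖ ^ 2 := by positivity
  rw [quadForm_designMatrix]
  constructor
  -- Young's inequality: `9 / 10 - 9 K τ² ≥ 4 / 5`, and below similarly `11 / 10 + 11 K τ² ≤ 5 / 4`.
  · have h1 : ∑ k, ∑ i, (9 / 10 * (u k i * x k ^ 2) - u k i * (9 * (τ ^ 2 * ‖toLp 2 x‖ ^ 2))) ≤
        ∑ k, ∑ i, u k i * (x ⬝ᵥ y i) ^ 2 := by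
      refine Finset.sum_le_sum fun k _ => Finset.sum_le_sum fun i _ => ?_
      by_cases h : u k i = 0
      · simp [h]
      obtain ⟨e, he1, he2⟩ := hdot k i h
      have h2 : 9 / 10 * x k ^ 2 - 9 * (τ ^ 2 * ‖toLp 2 x‖ ^ 2) ≤ (x ⬝ᵥ y i) ^ 2 := by
        rw [he1]
        nlinarith [sq_nonneg (x k + 10 * e)]
      have := mul_le_mul_of_nonneg_left h2 (hu0 k i)
      linarith
    simp only [Finset.sum_sub_distrib] at h1
    rw [he] at h1
    simp only [← Finset.mul_sum] at h1
    rw [← hx] at h1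
    nlinarith
  · have h1 : ∑ k, ∑ i, u k i * (x ⬝ᵥ y i) ^ 2 ≤
        ∑ k, ∑ i, (11 / 10 * (u k i * x k ^ 2) + u k i * (11 * (τ ^ 2 * ‖toLp 2 x‖ ^ 2))) := by
      refine Finset.sum_le_sum fun k _ => Finset.sum_le_sum fun i _ => ?_
      by_cases h : u k i = 0
      · simp [h]
      obtain ⟨e, he1, he2⟩ := hdot k i h
      have h2 : (x ⬝ᵥ y i) ^ 2 ≤ 11 / 10 * x k ^ 2 + 11 * (τ ^ 2 * ‖toLp 2 x‖ ^ 2) := by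
        rw [he1]
        nlinarith [sq_nonneg (x k - 10 * e)]
      have := mul_le_mul_of_nonneg_left h2 (hu0 k i)
      linarith
    simp only [Finset.sum_add_distrib] at h1
    rw [he] at h1
    simp only [← Finset.mul_sum] at h1
    rw [← hx] at h1
    nlinarith

/-- First-order condition: if the determinant does not increase along a segment that starts at a
nonsingular matrix `S` in direction `D`, then `tr (S⁻¹ D) ≤ 0`. -/
theorem trace_inv_mul_nonpos {S D : Matrix (Fin K) (Fin K) ℝ} (hS : 0 < S.det)
    (h : ∀ t : ℝ, 0 < t → t ≤ 1 → (S + t • D).det ≤ S.det) : (S⁻¹ * D).trace ≤ 0 := by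
  -- The remainder in `det (1 + t M) = 1 + t tr M + t² q(t)`, `M = S⁻¹ D`; divide by `t` and let `t`
  -- tend to `0` from above.
  set q := (Matrix.det (1 + (Polynomial.X : Polynomial ℝ) • (S⁻¹ * D).map Polynomial.C)).divX.divX
    with hq
  have h1 : ∀ t : ℝ, 0 < t → t ≤ 1 → (S⁻¹ * D).trace + q.eval t * t ≤ 0 := by
    intro t ht0 ht1
    have h2 : S + t • D = S * (1 + t • (S⁻¹ * D)) := by
      rw [mul_add, mul_one, mul_smul_comm, ← mul_assoc,
        Matrix.mul_nonsing_inv _ (isUnit_iff_ne_zero.2 hS.ne'), one_mul]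
    have h3 := h t ht0 ht1
    rw [h2, Matrix.det_mul, Matrix.det_one_add_smul] at h3
    change S.det * (1 + (S⁻¹ * D).trace * t + q.eval t * t ^ 2) ≤ S.det at h3
    have h4 : (1 + (S⁻¹ * D).trace * t + q.eval t * t ^ 2) ≤ 1 := by
      by_contra! hlt
      nlinarith
    refine le_of_mul_le_mul_right ?_ ht0
    linarith
  have h2 : Filter.Tendsto (fun t : ℝ => (S⁻¹ * D).trace + q.eval t * t) (nhdsWithin 0 (Set.Ioi 0))
      (nhds ((S⁻¹ * D).trace + q.eval 0 * 0)) := by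
    refine Filter.Tendsto.mono_left (Continuous.tendsto ?_ 0) nhdsWithin_le_nhds
    exact continuous_const.add (q.continuous.mul continuous_id)
  rw [mul_zero, add_zero] at h2
  refine le_of_tendsto h2 ?_
  filter_upwards [Ioc_mem_nhdsGT (zero_lt_one : (0 : ℝ) < 1)] with t ht
  exact h1 t ht.1 ht.2

end Design

/-! ### Conditioning of the minimum-volume ellipsoid -/

section MinimumVolume

open WithLp

variable {n K : ℕ}

theorem posDef_of_quadForm_lower {S : Matrix (Fin K) (Fin K) ℝ} (hS : S.IsSymm) {a : ℝ} (ha : 0 < a)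
    (h : ∀ x, a * ‖toLp 2 x‖ ^ 2 ≤ x ⬝ᵥ (S *ᵥ x)) : S.PosDef := by
  refine Matrix.PosDef.of_dotProduct_mulVec_pos ?_ fun {x} hx => ?_
  · rw [Matrix.IsHermitian, Matrix.conjTranspose_eq_transpose_of_trivial]; exact hS
  · rw [star_trivial]
    refine lt_of_lt_of_le ?_ (h x)
    have : 0 < ‖toLp 2 x‖ := by
      rw [norm_pos_iff]
      intro h0
      exact hx (congrArg ofLp h0)
    positivity

/-- For a cluster of points in a small ball, the mean leverage is almost at most one. -/
theorem sum_leverage_le {y : Fin n → Fin K → ℝ} {S : Matrix (Fin K) (Fin K) ℝ} (hS : S.IsSymm)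
    (hdet : S.det ≠ 0) {q : Fin n → ℝ} (hq0 : ∀ i, 0 ≤ q i) (hq1 : ∑ i, q i = 1)
    (hle : ∀ x, ∑ i, q i * (x ⬝ᵥ y i) ^ 2 ≤ x ⬝ᵥ (S *ᵥ x))
    (hM : ∀ x, x ⬝ᵥ (S⁻¹ *ᵥ x) ≤ 5 / 4 * ‖toLp 2 x‖ ^ 2) {c : Fin K → ℝ} {τ : ℝ}
    (hτ : ∀ i, q i ≠ 0 → ‖toLp 2 (y i - c)‖ ≤ τ) :
    ∑ i, q i * (y i ⬝ᵥ (S⁻¹ *ᵥ y i)) ≤ 1 + 2 * τ ^ 2 := by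
  have hMs : (S⁻¹).IsSymm := by
    rw [Matrix.IsSymm, Matrix.transpose_nonsing_inv, hS.eq]
  set m := ∑ i, q i • y i with hm
  -- The mean leverage is the leverage of the mean plus a spread. The former is at most `1` because
  -- `S` dominates `∑ q yyᵀ`, hence `mmᵀ`. The latter is at most `5 / 4 * τ²`, the mean being the
  -- best centre.
  have h1 : ∑ i, q i * (y i ⬝ᵥ (S⁻¹ *ᵥ y i)) =
      m ⬝ᵥ (S⁻¹ *ᵥ m) + ∑ i, q i * ((y i - m) ⬝ᵥ (S⁻¹ *ᵥ (y i - m))) := by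
    rw [sum_mul_quadForm_sub hMs hq1 y m, ← hm]; ring
  have h2 : m ⬝ᵥ (S⁻¹ *ᵥ m) ≤ 1 := by
    set z := S⁻¹ *ᵥ m with hz
    have hSz : S *ᵥ z = m := by
      rw [hz, Matrix.mulVec_mulVec, Matrix.mul_nonsing_inv _ (isUnit_iff_ne_zero.2 hdet),
        Matrix.one_mulVec]
    have h3 := hle z
    rw [hSz] at h3
    have h4 : z ⬝ᵥ m = ∑ i, q i * (z ⬝ᵥ y i) := by
      rw [hm, dotProduct_sum]
      simp
    have h5 : (z ⬝ᵥ m) ^ 2 ≤ ∑ i, q i * (z ⬝ᵥ y i) ^ 2 := by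
      rw [h4]
      exact Real.pow_arith_mean_le_arith_mean_pow_of_even Finset.univ q _ (fun i _ => hq0 i) hq1 even_two
    rw [dotProduct_comm]
    nlinarith
  have h3 : ∑ i, q i * ((y i - m) ⬝ᵥ (S⁻¹ *ᵥ (y i - m))) ≤
      5 / 4 * ∑ i, q i * ‖toLp 2 (y i - m)‖ ^ 2 := by
    rw [Finset.mul_sum]
    refine Finset.sum_le_sum fun i _ => ?_
    have := mul_le_mul_of_nonneg_left (hM (y i - m)) (hq0 i)
    linarith
  have h4 : ∑ i, q i * ‖toLp 2 (y i - m)‖ ^ 2 ≤ ∑ i, q i * ‖toLp 2 (y i - c)‖ ^ 2 := by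
    have e : ∀ c, ∑ i, q i * ‖toLp 2 (y i - c)‖ ^ 2 =
        ∑ i, q i * (y i ⬝ᵥ y i) - 2 * (c ⬝ᵥ m) + c ⬝ᵥ c := by
      intro c
      have := sum_mul_quadForm_sub (M := (1 : Matrix (Fin K) (Fin K) ℝ)) Matrix.isSymm_one hq1 y c
      simp only [Matrix.one_mulVec] at this
      simp only [norm_toLp_sq]
      exact this
    have h5 : 0 ≤ (c - m) ⬝ᵥ (c - m) := by rw [← norm_toLp_sq]; positivity
    rw [sub_dotProduct, dotProduct_sub, dotProduct_sub, dotProduct_comm m c] at h5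
    rw [e, e]
    linarith
  have h5 : ∑ i, q i * ‖toLp 2 (y i - c)‖ ^ 2 ≤ τ ^ 2 := by
    calc ∑ i, q i * ‖toLp 2 (y i - c)‖ ^ 2 ≤ ∑ i, q i * τ ^ 2 := by
          refine Finset.sum_le_sum fun i _ => ?_
          by_cases h : q i = 0
          · simp [h]
          · exact mul_le_mul_of_nonneg_left
              (pow_le_pow_left₀ (norm_nonneg _) (hτ i h) 2) (hq0 i)
      _ = τ ^ 2 := by rw [← Finset.sum_mul, hq1, one_mul]
  nlinarith [sq_nonneg τ]

/-- There are weights on the clusters for which all leverages are almost at most one: those that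
maximise the determinant of the design matrix among the weights of total mass one on each
cluster. -/
theorem exists_design {y : Fin n → Fin K → ℝ} {c : Fin K → Fin n → Prop} {p : Fin K → Fin n}
    (hp : ∀ k, c k (p k)) {τ : ℝ} (hclose : ∀ k i, c k i → ‖toLp 2 (y i - Pi.single k 1)‖ ≤ τ)
    (hτ : K * τ ^ 2 ≤ 1 / 100) :
    ∃ u : Fin K → Fin n → ℝ, (∀ k i, 0 ≤ u k i) ∧ (∀ k, ∑ i, u k i = 1) ∧
      (∀ k i, u k i ≠ 0 → c k i) ∧
      ∀ k i, c k i → y i ⬝ᵥ ((designMatrix y u)⁻¹ *ᵥ y i) ≤ 1 + 2 * τ ^ 2 := by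
  -- Fixing mass one on every cluster, not just the total mass, keeps `S` close to the identity;
  -- optimality then compares points within one cluster only.
  set W : Set (Fin K → Fin n → ℝ) :=
    Set.univ.pi fun k => stdSimplex ℝ (Fin n) ∩ {q | ∀ i, ¬ c k i → q i = 0} with hW
  have hWc : IsCompact W := by
    refine isCompact_univ_pi fun k => (isCompact_stdSimplex ℝ (Fin n)).inter_right ?_
    simp only [Set.ofPred_forall]
    exact isClosed_iInter fun i => isClosed_iInter fun _ =>
      isClosed_eq (continuous_apply i) continuous_const
  have hWne : W.Nonempty := by
    refine ⟨fun k => Pi.single (p k) 1, fun k _ => ⟨single_mem_stdSimplex ℝ (p k), ?_⟩⟩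
    intro i hi
    have : i ≠ p k := by rintro rfl; exact hi (hp k)
    exact Pi.single_eq_of_ne this 1
  have hcont : Continuous fun u : Fin K → Fin n → ℝ => (designMatrix y u).det := by
    refine Continuous.matrix_det ?_
    unfold designMatrix
    fun_prop
  obtain ⟨u, huW, humax⟩ := hWc.exists_isMaxOn hWne hcont.continuousOn
  have hu0 : ∀ k i, 0 ≤ u k i := fun k i => (huW k trivial).1.1 i
  have hu1 : ∀ k, ∑ i, u k i = 1 := fun k => (huW k trivial).1.2
  have huc : ∀ k i, u k i ≠ 0 → c k i := fun k i h => by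
    by_contra hc
    exact h ((huW k trivial).2 i hc)
  refine ⟨u, hu0, hu1, huc, fun k i hi => ?_⟩
  set S := designMatrix y u with hS
  have hSs : S.IsSymm := designMatrix_isSymm y u
  have hb := designMatrix_quadForm_bounds hu0 hu1 (fun k i h => hclose k i (huc k i h)) hτ
  have hSpd : S.PosDef := posDef_of_quadForm_lower hSs (by norm_num) fun x => (hb x).1
  have hdet : 0 < S.det := hSpd.det_pos
  have hM : ∀ x, x ⬝ᵥ (S⁻¹ *ᵥ x) ≤ 5 / 4 * ‖toLp 2 x‖ ^ 2 := fun x => by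
    have := (inv_quadForm_bounds hSs hdet.ne' (by norm_num) (by norm_num)
      (fun x => (hb x).1) (fun x => (hb x).2) x).2.2
    linarith
  -- The direction that moves the mass of cluster `k` to the point `i`. Optimality bounds the
  -- leverage of `i` by the mean leverage of its cluster.
  set D := Matrix.vecMulVec (y i) (y i) - ∑ j, u k j • Matrix.vecMulVec (y j) (y j) with hD
  have htr : (S⁻¹ * D).trace ≤ 0 := by
    refine trace_inv_mul_nonpos hdet fun t ht0 ht1 => ?_
    have hmem : Function.update u k ((1 - t) • u k + t • Pi.single i 1) ∈ W := by
      intro k' _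
      by_cases hk : k' = k
      · subst hk
        rw [Function.update_self]
        refine ⟨convex_stdSimplex ℝ (Fin n) (huW k' trivial).1 (single_mem_stdSimplex ℝ i)
          (by linarith) ht0.le (by ring), fun j hj => ?_⟩
        have hne : j ≠ i := by rintro rfl; exact hj hi
        simp [(huW k' trivial).2 j hj, hne]
      · rw [Function.update_of_ne hk]
        exact huW k' trivial
    have heq : S + t • D =
        designMatrix y (Function.update u k ((1 - t) • u k + t • Pi.single i 1)) := by
      rw [hS, designMatrix, designMatrix, ← Finset.add_sum_erase _ _ (Finset.mem_univ k),
        ← Finset.add_sum_erase Finset.univ _ (Finset.mem_univ k)]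
      have h1 : ∑ x ∈ Finset.univ.erase k, ∑ j, Function.update u k
          ((1 - t) • u k + t • Pi.single i 1) x j • Matrix.vecMulVec (y j) (y j) =
          ∑ x ∈ Finset.univ.erase k, ∑ j, u x j • Matrix.vecMulVec (y j) (y j) := by
        refine Finset.sum_congr rfl fun x hx => ?_
        rw [Function.update_of_ne (Finset.ne_of_mem_erase hx)]
      have h2 : ∑ j, ((1 - t) • u k + t • Pi.single i 1 : Fin n → ℝ) j • Matrix.vecMulVec (y j) (y j) =
          (1 - t) • ∑ j, u k j • Matrix.vecMulVec (y j) (y j) +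
            t • Matrix.vecMulVec (y i) (y i) := by
        simp only [Pi.add_apply, Pi.smul_apply, add_smul, Finset.sum_add_distrib, Finset.smul_sum,
          smul_assoc]
        congr 1
        rw [Finset.sum_eq_single i]
        · simp
        · intro j _ hj
          simp [hj]
        · simp
      rw [h1, Function.update_self, h2, hD, smul_sub, sub_smul, one_smul]
      abel
    rw [heq]
    exact humax hmem
  have h1 : (S⁻¹ * D).trace =
      y i ⬝ᵥ (S⁻¹ *ᵥ y i) - ∑ j, u k j * (y j ⬝ᵥ (S⁻¹ *ᵥ y j)) := by
    rw [hD, mul_sub, Matrix.trace_sub, trace_mul_vecMulVec_self, Finset.mul_sum, Matrix.trace_sum]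
    congr 1
    refine Finset.sum_congr rfl fun j _ => ?_
    rw [mul_smul_comm, Matrix.trace_smul, trace_mul_vecMulVec_self, smul_eq_mul]
  have h2 := sum_leverage_le hSs hdet.ne' (hu0 k) (hu1 k) (fun x => ?_) hM
    fun j hj => hclose k j (huc k j hj)
  · linarith
  · rw [hS, quadForm_designMatrix]
    exact Finset.single_le_sum (f := fun k => ∑ i, u k i * (x ⬝ᵥ y i) ^ 2)
      (fun k _ => Finset.sum_nonneg fun i _ => mul_nonneg (hu0 k i) (sq_nonneg _))
      (Finset.mem_univ k)

/-- Points that are not close to a vertex lie well inside the ellipsoid. -/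
theorem quadForm_le_of_not_near_vertex {M : Matrix (Fin K) (Fin K) ℝ} (hM : M.IsSymm) {b η : ℝ}
    (hlow : ∀ x, 4 / 5 * ‖toLp 2 x‖ ^ 2 ≤ x ⬝ᵥ (M *ᵥ x))
    (hup : ∀ x, x ⬝ᵥ (M *ᵥ x) ≤ 5 / 4 * ‖toLp 2 x‖ ^ 2)
    (hop : ∀ x, ‖toLp 2 (M *ᵥ x)‖ ≤ 5 / 4 * ‖toLp 2 x‖)
    (hdiag : ∀ k, Pi.single k 1 ⬝ᵥ (M *ᵥ Pi.single k 1) ≤ b)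
    {t y : Fin K → ℝ} (ht0 : ∀ k, 0 ≤ t k) (ht1 : ∑ k, t k = 1) (ht : ∀ k, t k ≤ 1 - 4 * η)
    (hy : ‖toLp 2 (y - t)‖ ≤ η) (hη : η ≤ 1 / 5) : y ⬝ᵥ (M *ᵥ y) ≤ b := by
  have hη0 : 0 ≤ η := (norm_nonneg _).trans hy
  have hmean : ∑ k, t k • (Pi.single k 1 : Fin K → ℝ) = t := by
    ext j
    simp [Finset.sum_apply, Pi.single_apply]
  -- So the vertices have variance at least `4 η` under `t`, and convexity gains `4 / 5 * 4 η`. This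
  -- beats the cost `5 / 2 * η + 5 / 4 * η²` of moving from `t` to `y`.
  have htn : ‖toLp 2 t‖ ^ 2 ≤ 1 - 4 * η := by
    rw [norm_toLp_sq, dotProduct]
    calc ∑ k, t k * t k ≤ ∑ k, t k * (1 - 4 * η) :=
          Finset.sum_le_sum fun k _ => mul_le_mul_of_nonneg_left (ht k) (ht0 k)
      _ = _ := by rw [← Finset.sum_mul, ht1, one_mul]
  have hvar1 : ∑ k, t k * ‖toLp 2 (Pi.single k 1 - t)‖ ^ 2 = 1 - ‖toLp 2 t‖ ^ 2 := by
    have := sum_mul_quadForm_sub (M := (1 : Matrix (Fin K) (Fin K) ℝ)) Matrix.isSymm_one ht1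
      (fun k => Pi.single k 1) t
    rw [hmean] at this
    simp only [Matrix.one_mulVec, ← norm_toLp_sq] at this
    rw [this]
    have h1 : ∀ k, ‖toLp 2 (Pi.single k (1 : ℝ) : Fin K → ℝ)‖ = 1 := fun k =>
      (PiLp.norm_single 2 (fun _ : Fin K => ℝ) k (1 : ℝ)).trans (by simp)
    simp only [h1, one_pow, mul_one, ht1]
    ring
  have hvarM := sum_mul_quadForm_sub hM ht1 (fun k => (Pi.single k 1 : Fin K → ℝ)) t
  rw [hmean] at hvarM
  have h1 : ∑ k, t k * (4 / 5 * ‖toLp 2 (Pi.single k 1 - t)‖ ^ 2) ≤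
      ∑ k, t k * ((Pi.single k 1 - t) ⬝ᵥ (M *ᵥ (Pi.single k 1 - t))) :=
    Finset.sum_le_sum fun k _ => mul_le_mul_of_nonneg_left (hlow _) (ht0 k)
  have h2 : ∑ k, t k * (Pi.single k 1 ⬝ᵥ (M *ᵥ Pi.single k 1)) ≤ b := by
    calc _ ≤ ∑ k, t k * b :=
          Finset.sum_le_sum fun k _ => mul_le_mul_of_nonneg_left (hdiag k) (ht0 k)
      _ = b := by rw [← Finset.sum_mul, ht1, one_mul]
  have h3 : ∑ k, t k * (4 / 5 * ‖toLp 2 (Pi.single k 1 - t)‖ ^ 2) =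
      4 / 5 * (1 - ‖toLp 2 t‖ ^ 2) := by
    rw [← hvar1, Finset.mul_sum]
    exact Finset.sum_congr rfl fun k _ => by ring
  set r := y - t with hr
  have hyr : y = t + r := by rw [hr]; abel
  have h4 : y ⬝ᵥ (M *ᵥ y) = t ⬝ᵥ (M *ᵥ t) + 2 * (r ⬝ᵥ (M *ᵥ t)) + r ⬝ᵥ (M *ᵥ r) := by
    rw [hyr, Matrix.mulVec_add, add_dotProduct, dotProduct_add, dotProduct_add,
      dotProduct_mulVec_comm hM t r]
    ring
  have ht1' : ‖toLp 2 t‖ ≤ 1 := by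
    refine le_of_sq_le_sq ?_ zero_le_one
    linarith
  have h5 : r ⬝ᵥ (M *ᵥ t) ≤ 5 / 4 * η := by
    calc r ⬝ᵥ (M *ᵥ t) ≤ ‖toLp 2 r‖ * ‖toLp 2 (M *ᵥ t)‖ :=
          (le_abs_self _).trans (abs_dotProduct_le _ _)
      _ ≤ η * (5 / 4 * 1) := by
          refine mul_le_mul hy ((hop t).trans ?_) (norm_nonneg _) hη0
          linarith
      _ = _ := by ring
  have h6 : r ⬝ᵥ (M *ᵥ r) ≤ 5 / 4 * η ^ 2 := by
    refine (hup r).trans ?_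
    have := pow_le_pow_left₀ (norm_nonneg _) hy 2
    linarith
  nlinarith

/-- The minimum-volume ellipsoid of a near-separable configuration of points around the standard
simplex is well-conditioned. -/
theorem minVolume_bounds {θ y : Fin n → Fin K → ℝ} (hθ0 : ∀ i l, 0 ≤ θ i l)
    (hθ1 : ∀ i, ∑ l, θ i l = 1) {p : Fin K → Fin n} (hpθ : ∀ k, θ (p k) k = 1)
    (hpy : ∀ k, y (p k) = Pi.single k 1) {η : ℝ} (hη0 : 0 ≤ η)
    (hy : ∀ i, ‖toLp 2 (y i - θ i)‖ ≤ η)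
    (hη : √K * η ≤ 1 / 90) {R : Matrix (Fin K) (Fin K) ℝ} (hRdet : R.det ≠ 0)
    (hR : ∀ i, ‖toLp 2 (R *ᵥ y i)‖ ≤ 1)
    (hmax : ∀ N : Matrix (Fin K) (Fin K) ℝ, N.PosDef → (∀ i, y i ⬝ᵥ (N *ᵥ y i) ≤ 1) →
      N.det ≤ R.det ^ 2) (x : Fin K → ℝ) :
    1 / 2 * ‖toLp 2 x‖ ≤ ‖toLp 2 (R *ᵥ x)‖ ∧ ‖toLp 2 (R *ᵥ x)‖ ≤ 2 * ‖toLp 2 x‖ := by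
  rcases Nat.eq_zero_or_pos K with hK | hK
  · subst hK
    have h0 : ∀ z : Fin 0 → ℝ, ‖toLp 2 z‖ = 0 := fun z => by
      rw [norm_eq_zero]; ext i; exact i.elim0
    simp [h0]
  have hK1 : 1 ≤ √(K : ℝ) := by
    rw [Real.one_le_sqrt]; exact_mod_cast hK
  have hη1 : η ≤ 1 / 90 := by nlinarith
  set τ := 9 * η with hτdef
  have hKτ : K * τ ^ 2 ≤ 1 / 100 := by
    have h1 : (K : ℝ) * τ ^ 2 = 81 * (√K * η) ^ 2 := by
      rw [hτdef, mul_pow (√(K : ℝ)), Real.sq_sqrt (by positivity)]; ring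
    rw [h1]
    have := pow_le_pow_left₀ (by positivity) hη 2
    linarith
  -- Noise `η` plus `2 * 4 η` from the missing weight.
  have hclose : ∀ k i, 1 - 4 * η ≤ θ i k → ‖toLp 2 (y i - Pi.single k 1)‖ ≤ τ := by
    intro k i h
    have h1 := norm_sum_smul_sub_le (E := EuclideanSpace ℝ (Fin K)) (hθ0 i) (hθ1 i)
      (v := fun l => toLp 2 (Pi.single l (1 : ℝ))) (c := 1) (fun l =>
        ((PiLp.norm_single 2 (fun _ : Fin K => ℝ) l (1 : ℝ)).trans (by simp)).le) k
    have h2 : toLp 2 (y i - Pi.single k 1) = toLp 2 (y i - θ i) +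
        (∑ l, θ i l • toLp 2 (Pi.single l (1 : ℝ)) -
          toLp 2 (Pi.single k (1 : ℝ)) : EuclideanSpace ℝ (Fin K)) := by
      ext j
      simp [Pi.single_apply]
    rw [h2]
    refine (norm_add_le _ _).trans ?_
    linarith [hy i]
  obtain ⟨u, hu0, hu1, huc, hlev⟩ := exists_design (c := fun k i => 1 - 4 * η ≤ θ i k) (p := p)
    (fun k => by rw [hpθ]; linarith) hclose hKτ
  set S := designMatrix y u with hS
  have hSs : S.IsSymm := designMatrix_isSymm y u
  have hb := designMatrix_quadForm_bounds hu0 hu1 (fun k i h => hclose k i (huc k i h)) hKτ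
  have hSpd : S.PosDef := posDef_of_quadForm_lower hSs (by norm_num) fun x => (hb x).1
  have hdet : 0 < S.det := hSpd.det_pos
  have hinv := inv_quadForm_bounds hSs hdet.ne' (by norm_num) (by norm_num)
      (fun x => (hb x).1) (fun x => (hb x).2)
  have hMs : (S⁻¹).IsSymm := by rw [Matrix.IsSymm, Matrix.transpose_nonsing_inv, hSs.eq]
  set b := 1 + 2 * τ ^ 2 with hbdef
  have hb0 : 0 < b := by positivity
  have hfeas : ∀ i, y i ⬝ᵥ (S⁻¹ *ᵥ y i) ≤ b := by
    intro i
    by_cases hi : ∃ k, 1 - 4 * η ≤ θ i k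
    · obtain ⟨k, hk⟩ := hi
      exact hlev k i hk
    · push Not at hi
      refine quadForm_le_of_not_near_vertex hMs (fun x => ?_) (fun x => ?_) (fun x => ?_)
        (fun k => ?_) (hθ0 i) (hθ1 i) (fun k => (hi k).le) (hy i) (by linarith)
      · linarith [(hinv x).2.1]
      · linarith [(hinv x).2.2]
      · linarith [(hinv x).1]
      · rw [← hpy]
        exact hlev k (p k) (by rw [hpθ]; linarith)
  have hN := hmax (b⁻¹ • S⁻¹) (hSpd.inv.smul (inv_pos.2 hb0)) fun i => by
    rw [Matrix.smul_mulVec, dotProduct_smul, smul_eq_mul, inv_mul_eq_div, div_le_one hb0]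
    exact hfeas i
  -- Containment of the points bounds the trace of `X`; maximality of `R`, tested against `b⁻¹ S⁻¹`,
  -- bounds its determinant.
  set X := R * S * Rᵀ with hX
  have hXpd : X.PosDef := by
    have := hSpd.mul_mul_conjTranspose_same (B := R)
      (Matrix.vecMul_injective_of_isUnit ((Matrix.isUnit_iff_isUnit_det R).2 hRdet.isUnit))
    rwa [Matrix.conjTranspose_eq_transpose_of_trivial] at this
  have hXtr : X.trace ≤ K := by
    have h1 : X.trace = ∑ k, ∑ i, u k i * ‖toLp 2 (R *ᵥ y i)‖ ^ 2 := by
      rw [hX, hS, designMatrix, Matrix.mul_sum, Matrix.sum_mul, Matrix.trace_sum]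
      refine Finset.sum_congr rfl fun k _ => ?_
      rw [Matrix.mul_sum, Matrix.sum_mul, Matrix.trace_sum]
      refine Finset.sum_congr rfl fun i _ => ?_
      rw [mul_smul_comm, smul_mul_assoc, Matrix.trace_smul, Matrix.mul_vecMulVec,
        Matrix.vecMulVec_mul, Matrix.vecMul_transpose, Matrix.trace_vecMulVec, norm_toLp_sq,
        smul_eq_mul]
    rw [h1]
    calc ∑ k, ∑ i, u k i * ‖toLp 2 (R *ᵥ y i)‖ ^ 2 ≤ ∑ k, ∑ i, u k i := by
          refine Finset.sum_le_sum fun k _ => Finset.sum_le_sum fun i _ => ?_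
          refine mul_le_of_le_one_right (hu0 k i) ?_
          exact pow_le_one₀ (norm_nonneg _) (hR i)
      _ = K := by simp [hu1]
  have hXdet : Real.exp (-(1 / 50)) ≤ X.det := by
    have h1 : X.det = R.det ^ 2 * S.det := by
      rw [hX, Matrix.det_mul, Matrix.det_mul, Matrix.det_transpose]; ring
    rw [Matrix.det_smul, Matrix.det_nonsing_inv, Ring.inverse_eq_inv', Fintype.card_fin] at hN
    have h2 : (b⁻¹) ^ K ≤ X.det := by
      rw [h1]
      calc (b⁻¹) ^ K = (b⁻¹) ^ K * (S.det)⁻¹ * S.det := by field_simp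
        _ ≤ _ := by gcongr
    -- Here it matters that `b` exceeds `1` only to second order: the exponent is `2 K τ²`.
    have h3 : b ^ K ≤ Real.exp (1 / 50) := by
      calc b ^ K ≤ (Real.exp (2 * τ ^ 2)) ^ K := by
            refine pow_le_pow_left₀ hb0.le ?_ K
            have := Real.add_one_le_exp (2 * τ ^ 2)
            linarith
        _ = Real.exp (K * (2 * τ ^ 2)) := by rw [← Real.exp_nat_mul]
        _ ≤ _ := by
            rw [Real.exp_le_exp]
            linarith
    refine le_trans ?_ h2
    rw [Real.exp_neg, inv_pow]
    gcongr
  have hXb := quadForm_bounds_of_trace_of_det hXpd hXtr hXdet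
  have hXq : ∀ z, z ⬝ᵥ (X *ᵥ z) = (Rᵀ *ᵥ z) ⬝ᵥ (S *ᵥ (Rᵀ *ᵥ z)) := by
    intro z
    rw [hX, ← Matrix.mulVec_mulVec, ← Matrix.mulVec_mulVec, Matrix.dotProduct_mulVec,
      Matrix.mulVec_transpose]
  have hlowT : ∀ z, 1 / 2 * ‖toLp 2 z‖ ≤ ‖toLp 2 (Rᵀ *ᵥ z)‖ := by
    intro z
    refine le_of_sq_le_sq ?_ (norm_nonneg _)
    have h1 := (hXb z).1
    rw [hXq] at h1
    have h2 := (hb (Rᵀ *ᵥ z)).2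
    have h3 : 0 ≤ ‖toLp 2 z‖ ^ 2 := by positivity
    nlinarith
  have hupT : ‖Rᵀ‖ ≤ 2 := by
    refine opNorm_le_of_mulVec zero_le_two fun z => ?_
    refine le_of_sq_le_sq ?_ (by positivity)
    have h1 := (hXb z).2
    rw [hXq] at h1
    have h2 := (hb (Rᵀ *ᵥ z)).1
    have h3 : 0 ≤ ‖toLp 2 z‖ ^ 2 := by positivity
    nlinarith
  constructor
  · have := lower_bound_transpose (M := Rᵀ) (by rwa [Matrix.det_transpose]) (by norm_num) hlowT x
    rwa [Matrix.transpose_transpose] at this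
  · rw [norm_transpose_eq] at hupT
    exact (norm_mulVec_le R x).trans (mul_le_mul_of_nonneg_right hupT (norm_nonneg _))

end MinimumVolume

/-! ### Preconditioned successive projection -/

section Preconditioned

open WithLp

variable {n K : ℕ}

open scoped MatrixOrder in
theorem exists_posDef_mul_self_eq {N : Matrix (Fin K) (Fin K) ℝ} (hN : N.PosDef) :
    ∃ Q : Matrix (Fin K) (Fin K) ℝ, Q.PosDef ∧ Q * Q = N := by
  have h0 : 0 ≤ N := Matrix.nonneg_iff_posSemidef.2 hN.posSemidef
  have hs : CFC.sqrt N * CFC.sqrt N = N := CFC.sqrt_mul_sqrt_self N h0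
  refine ⟨CFC.sqrt N, ?_, hs⟩
  have hps : (CFC.sqrt N).PosSemidef := Matrix.nonneg_iff_posSemidef.1 (CFC.sqrt_nonneg N)
  rw [hps.posDef_iff_det_ne_zero]
  intro h
  have := hN.det_pos
  rw [← hs, Matrix.det_mul, h, zero_mul] at this
  exact lt_irrefl _ this

/-- Equivariance: a competitor `N` in the coordinates `y` becomes `G⁻¹ N G⁻ᵀ` for the points `g`,
and its positive square root competes with `Q`. So `R = Q Gᵀ`, though perhaps not symmetric, is
extremal for the points `y`. -/
theorem IsPreconditionedSPAOutput.exists_perm {θ y : Fin n → Fin K → ℝ} (hθ0 : ∀ i l, 0 ≤ θ i l)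
    (hθ1 : ∀ i, ∑ l, θ i l = 1) {p : Fin K → Fin n} (hpθ : ∀ k, θ (p k) k = 1)
    (hpy : ∀ k, y (p k) = Pi.single k 1) {η : ℝ} (hη0 : 0 ≤ η)
    (hy : ∀ i, ‖toLp 2 (y i - θ i)‖ ≤ η) (hη : √K * η ≤ 1 / 6000)
    {G : Matrix (Fin K) (Fin K) ℝ} (hG : G.det ≠ 0) {J : Fin K → Fin n}
    {g : Fin n → EuclideanSpace ℝ (Fin K)} (hg : ∀ i, g i = toLp 2 (Gᵀ *ᵥ y i))
    (hJ : IsPreconditionedSPAOutput g J) :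
    ∃ σ : Equiv.Perm (Fin K), ∀ k, 1 - 160 * η ≤ θ (J k) (σ k) := by
  obtain ⟨Q, hQ, hJ⟩ := hJ
  set R := Q * Gᵀ with hR
  have hQg : ∀ i, Matrix.toEuclideanLin Q (g i) = toLp 2 (R *ᵥ y i) := by
    intro i
    rw [hg, hR, ← Matrix.mulVec_mulVec]
    rfl
  have hGu : IsUnit G.det := hG.isUnit
  have hRdet : R.det = Q.det * G.det := by rw [hR, Matrix.det_mul, Matrix.det_transpose]
  have hbounds := minVolume_bounds hθ0 hθ1 hpθ hpy hη0 hy (by linarith) (R := R)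
    (by rw [hRdet]; exact mul_ne_zero hQ.posDef.det_pos.ne' hG)
    (fun i => by rw [← hQg]; exact hQ.contains i) (by
      intro N hN hNy
      have hN' : (G⁻¹ * N * (G⁻¹)ᵀ).PosDef := by
        have hinj : Function.Injective (Matrix.vecMul · G⁻¹) :=
          Matrix.vecMul_injective_of_isUnit
            ((Matrix.isUnit_nonsing_inv_iff).2 ((Matrix.isUnit_iff_isUnit_det G).2 hGu))
        have := hN.mul_mul_conjTranspose_same hinj
        rwa [Matrix.conjTranspose_eq_transpose_of_trivial] at this
      obtain ⟨Q', hQ', hQQ⟩ := exists_posDef_mul_self_eq hN'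
      have hQs : Q'ᵀ = Q' := by
        rw [← Matrix.conjTranspose_eq_transpose_of_trivial]; exact hQ'.1
      have h1 := hQ.minimal Q' hQ' fun i => by
        refine le_of_sq_le_sq ?_ zero_le_one
        rw [one_pow, hg]
        change ‖toLp 2 (Q' *ᵥ (Gᵀ *ᵥ y i))‖ ^ 2 ≤ 1
        have h2 : (Gᵀ *ᵥ y i) ⬝ᵥ ((Q' * Q') *ᵥ (Gᵀ *ᵥ y i)) = y i ⬝ᵥ (N *ᵥ y i) := by
          rw [hQQ, Matrix.mulVec_mulVec, Matrix.mul_assoc (G⁻¹ * N), ← Matrix.transpose_mul,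
            Matrix.mul_nonsing_inv _ hGu, Matrix.transpose_one, Matrix.mul_one,
            Matrix.mulVec_transpose, ← Matrix.dotProduct_mulVec, Matrix.mulVec_mulVec,
            ← Matrix.mul_assoc, Matrix.mul_nonsing_inv _ hGu, Matrix.one_mul]
        rw [norm_toLp_sq]
        have h3 : ∀ z : Fin K → ℝ, (Q' *ᵥ z) ⬝ᵥ (Q' *ᵥ z) = z ⬝ᵥ ((Q' * Q') *ᵥ z) := by
          intro z
          rw [← Matrix.mulVec_mulVec, Matrix.dotProduct_mulVec z, ← Matrix.mulVec_transpose, hQs]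
        rw [h3, h2]
        exact hNy i
      have h4 : N.det = (Q'.det * G.det) ^ 2 := by
        have h5 : Q'.det * Q'.det = (G⁻¹).det * N.det * (G⁻¹).det := by
          rw [← Matrix.det_mul, hQQ, Matrix.det_mul, Matrix.det_mul, Matrix.det_transpose]
        rw [Matrix.det_nonsing_inv, Ring.inverse_eq_inv'] at h5
        rw [mul_pow, sq Q'.det, h5]
        field_simp
      rw [h4, hRdet, mul_pow, mul_pow]
      exact mul_le_mul_of_nonneg_right (pow_le_pow_left₀ hQ'.det_pos.le h1 2) (sq_nonneg _))
  have hsum : ∀ a : Fin K → ℝ, ∑ l, a l • toLp 2 (R *ᵥ Pi.single l 1) = toLp 2 (R *ᵥ a) := by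
    intro a
    ext j
    simp [Matrix.mulVec, dotProduct, mul_comm]
  refine IsSPAChoice.exists_perm hθ0 hθ1 (v := fun l => toLp 2 (R *ᵥ Pi.single l 1))
    (ρ := fun i => toLp 2 (R *ᵥ (y i - θ i))) (fun a => ?_) (fun l => ?_) (fun i => ?_)
    (fun i => ?_) (p := p) (fun l => ?_) hη hJ
  · rw [hsum]
    exact (hbounds a).1
  · have h1 := (hbounds (Pi.single l 1)).2
    have h2 : ‖toLp 2 (Pi.single l (1 : ℝ) : Fin K → ℝ)‖ = 1 :=
      (PiLp.norm_single 2 (fun _ : Fin K => ℝ) l (1 : ℝ)).trans (by simp)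
    rwa [h2, mul_one] at h1
  · rw [hQg, hsum, ← toLp_add, ← Matrix.mulVec_add, add_sub_cancel]
  · exact ((hbounds _).2).trans (mul_le_mul_of_nonneg_left (hy i) zero_le_two)
  · rw [hQg, hpy]

end Preconditioned

/-! ### Perturbation of eigenvectors, in norm and by rows -/

section EigenspacePerturbation

open WithLp

variable {n K : ℕ} {A P : Matrix (Fin n) (Fin n) ℝ} {U V : Matrix (Fin n) (Fin K) ℝ}
  {l d : Fin K → ℝ}

theorem norm_inv_diagonal_le {c : ℝ} (hc : 0 < c) (hd : ∀ k, c ≤ |d k|) :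
    ‖(Matrix.diagonal fun k => (d k)⁻¹ : Matrix (Fin K) (Fin K) ℝ)‖ ≤ c⁻¹ := by
  refine norm_diagonal_le (by positivity) fun k => ?_
  rw [abs_inv]
  exact inv_anti₀ hc (hd k)

theorem diagonal_mul_inv_diagonal (hd : ∀ k, d k ≠ 0) :
    Matrix.diagonal d * Matrix.diagonal (fun k => (d k)⁻¹) = 1 := by
  rw [Matrix.diagonal_mul_diagonal, ← Matrix.diagonal_one]
  congr 1
  ext k
  exact mul_inv_cancel₀ (hd k)

theorem inv_diagonal_mul_diagonal (hd : ∀ k, d k ≠ 0) :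
    Matrix.diagonal (fun k => (d k)⁻¹) * Matrix.diagonal d = 1 := by
  rw [Matrix.diagonal_mul_diagonal, ← Matrix.diagonal_one]
  congr 1
  ext k
  exact inv_mul_cancel₀ (hd k)

/-- Leading eigenvectors of `A` are close to the span of the leading eigenvectors of `P`. -/
theorem norm_eigenvectors_sub_le (hV : IsLeadingEigen A V d) (hU : IsLeadingEigen P U l)
    (hPU : U * (Uᵀ * P) = P) {c : ℝ} (hc : 0 < c) (hd : ∀ k, c ≤ |d k|) :
    ‖V - U * (Uᵀ * V)‖ ≤ 2 * ‖A - P‖ / c := by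
  have hd0 : ∀ k, d k ≠ 0 := fun k h => by have := hd k; rw [h, abs_zero] at this; linarith
  have hU1 := norm_le_one_of_transpose_mul_self hU.orthonormal
  have hV1 := norm_le_one_of_transpose_mul_self hV.orthonormal
  have h1 : V - U * (Uᵀ * V) = ((A - P) * V - U * (Uᵀ * ((A - P) * V))) *
      Matrix.diagonal fun k => (d k)⁻¹ := by
    -- The columns of `P V` lie in the range of `U`, so projecting them off leaves nothing.
    have h2 : (A - P) * V - U * (Uᵀ * ((A - P) * V)) =
        (V - U * (Uᵀ * V)) * Matrix.diagonal d := by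
      have h3 : U * (Uᵀ * (P * V)) = P * V := by
        rw [← Matrix.mul_assoc Uᵀ, ← Matrix.mul_assoc U, hPU]
      rw [Matrix.sub_mul, Matrix.mul_sub, Matrix.mul_sub, h3, hV.eigen, Matrix.sub_mul,
        Matrix.mul_assoc U, Matrix.mul_assoc Uᵀ]
      abel
    rw [h2, Matrix.mul_assoc, diagonal_mul_inv_diagonal hd0, Matrix.mul_one]
  have h4 : ‖(A - P) * V‖ ≤ ‖A - P‖ :=
    (Matrix.l2_opNorm_mul _ _).trans (mul_le_of_le_one_right (norm_nonneg _) hV1)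
  have h5 : ‖U * (Uᵀ * ((A - P) * V))‖ ≤ ‖A - P‖ := by
    refine (Matrix.l2_opNorm_mul _ _).trans ?_
    refine (mul_le_of_le_one_left (norm_nonneg _) hU1).trans ?_
    refine (Matrix.l2_opNorm_mul _ _).trans ?_
    rw [norm_transpose_eq]
    exact (mul_le_of_le_one_left (norm_nonneg _) hU1).trans h4
  rw [h1, div_eq_mul_inv]
  refine (Matrix.l2_opNorm_mul _ _).trans ?_
  refine mul_le_mul ?_ (norm_inv_diagonal_le hc hd) (norm_nonneg _) (by positivity)
  refine (norm_sub_le _ _).trans ?_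
  linarith

theorem diagonal_mul_sub_mul_diagonal (hV : IsLeadingEigen A V d) (hU : IsLeadingEigen P U l)
    (hP : P.IsSymm) :
    Uᵀ * V * Matrix.diagonal d = Matrix.diagonal l * (Uᵀ * V) + Uᵀ * ((A - P) * V) := by
  rw [Matrix.sub_mul, Matrix.mul_sub, hV.eigen, ← Matrix.mul_assoc Uᵀ P, hU.transpose_mul hP,
    Matrix.mul_assoc, Matrix.mul_assoc]
  abel

/-- Row-wise perturbation bound for leading eigenvectors. -/
theorem norm_rowVec_eigenvectors_sub_le (hV : IsLeadingEigen A V d) (hU : IsLeadingEigen P U l)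
    (hP : P.IsSymm) (hPU : U * (Uᵀ * P) = P) {c : ℝ} (hc : 0 < c) (hd : ∀ k, c / 2 ≤ |d k|)
    (hl : ∀ k, c ≤ |l k|) (i : Fin n) :
    ‖rowVec (V - U * (Uᵀ * V)) i‖ ≤
      10 * (‖rowVec A i‖ * ‖A - P‖ / c ^ 2) + ‖rowVec ((A - P) * U) i‖ / c := by
  have hd0 : ∀ k, d k ≠ 0 := fun k h => by have := hd k; rw [h, abs_zero] at this; linarith
  have hl0 : ∀ k, l k ≠ 0 := fun k h => by have := hl k; rw [h, abs_zero] at this; linarith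
  have hU1 := norm_le_one_of_transpose_mul_self hU.orthonormal
  have hV1 := norm_le_one_of_transpose_mul_self hV.orthonormal
  set H := Uᵀ * V with hH
  set Di : Matrix (Fin K) (Fin K) ℝ := Matrix.diagonal fun k => (d k)⁻¹ with hDi
  set Li : Matrix (Fin K) (Fin K) ℝ := Matrix.diagonal fun k => (l k)⁻¹ with hLi
  have hDn : ‖Di‖ ≤ 2 / c := by
    have := norm_inv_diagonal_le (half_pos hc) hd
    rwa [inv_div] at this
  have hLn : ‖Li‖ ≤ 1 / c := by
    have := norm_inv_diagonal_le hc hl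
    rwa [inv_eq_one_div] at this
  have hH1 : ‖H‖ ≤ 1 := by
    refine (Matrix.l2_opNorm_mul _ _).trans ?_
    rw [norm_transpose_eq]
    exact mul_le_one₀ hU1 (norm_nonneg _) hV1
  have hR := norm_eigenvectors_sub_le hV hU hPU (half_pos hc) hd
  have hcomm := diagonal_mul_sub_mul_diagonal hV hU hP
  rw [← hH] at hcomm
  have h1 : H * Di - Li * H = -(Li * (Uᵀ * ((A - P) * V)) * Di) := by
    have h2 : Uᵀ * ((A - P) * V) = H * Matrix.diagonal d - Matrix.diagonal l * H := by
      rw [hcomm]; abel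
    rw [h2, mul_sub, ← mul_assoc Li (Matrix.diagonal l), inv_diagonal_mul_diagonal hl0, one_mul,
      sub_mul, mul_assoc Li, mul_assoc H, diagonal_mul_inv_diagonal hd0, mul_one]
    abel
  -- From `V = A V Di` and `U H = P U Li H`. Rows of `A` meet only factors of norm `O(‖A - P‖ /
  -- c²)`, with constants `8` and `2`; the last term keeps the row of `(A - P) U` that occurs in
  -- `β`.
  have hdec : V - U * H = A * ((V - U * H) * Di) + A * (U * (H * Di - Li * H)) +
      (A - P) * U * (Li * H) := by
    have hVD : A * (V * Di) = V := by
      rw [← Matrix.mul_assoc, hV.eigen, Matrix.mul_assoc, diagonal_mul_inv_diagonal hd0,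
        Matrix.mul_one]
    have hUL : P * U * (Li * H) = U * H := by
      rw [hU.eigen, Matrix.mul_assoc, ← Matrix.mul_assoc (Matrix.diagonal l),
        diagonal_mul_inv_diagonal hl0, Matrix.one_mul]
    rw [Matrix.sub_mul V, Matrix.mul_sub, hVD, Matrix.mul_sub U, Matrix.mul_sub A,
      Matrix.sub_mul A P U, Matrix.sub_mul (A * U), hUL]
    simp only [Matrix.mul_assoc]
    abel
  have hE := norm_nonneg (A - P)
  have t1 : ‖rowVec (A * ((V - U * H) * Di)) i‖ ≤ 8 * (‖rowVec A i‖ * ‖A - P‖ / c ^ 2) := by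
    refine (norm_rowVec_mul_le _ _ _).trans ?_
    have : ‖(V - U * H) * Di‖ ≤ 2 * ‖A - P‖ / (c / 2) * (2 / c) :=
      (Matrix.l2_opNorm_mul _ _).trans (mul_le_mul hR hDn (norm_nonneg _) (by positivity))
    refine (mul_le_mul_of_nonneg_left this (norm_nonneg _)).trans (le_of_eq ?_)
    field_simp
    ring
  have t2 : ‖rowVec (A * (U * (H * Di - Li * H))) i‖ ≤
      2 * (‖rowVec A i‖ * ‖A - P‖ / c ^ 2) := by
    refine (norm_rowVec_mul_le _ _ _).trans ?_
    have e1 : ‖Uᵀ * ((A - P) * V)‖ ≤ ‖A - P‖ := by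
      refine (Matrix.l2_opNorm_mul _ _).trans ?_
      rw [norm_transpose_eq]
      refine (mul_le_of_le_one_left (norm_nonneg _) hU1).trans ?_
      exact (Matrix.l2_opNorm_mul _ _).trans (mul_le_of_le_one_right (norm_nonneg _) hV1)
    have e2 : ‖U * (H * Di - Li * H)‖ ≤ 1 / c * ‖A - P‖ * (2 / c) := by
      refine (Matrix.l2_opNorm_mul _ _).trans ?_
      refine (mul_le_of_le_one_left (norm_nonneg _) hU1).trans ?_
      rw [h1, norm_neg]
      refine (Matrix.l2_opNorm_mul _ _).trans (mul_le_mul ?_ hDn (norm_nonneg _) (by positivity))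
      exact (Matrix.l2_opNorm_mul _ _).trans (mul_le_mul hLn e1 (norm_nonneg _) (by positivity))
    refine (mul_le_mul_of_nonneg_left e2 (norm_nonneg _)).trans (le_of_eq ?_)
    field_simp
  have t3 : ‖rowVec ((A - P) * U * (Li * H)) i‖ ≤ ‖rowVec ((A - P) * U) i‖ / c := by
    refine (norm_rowVec_mul_le _ _ _).trans ?_
    rw [div_eq_mul_one_div]
    refine mul_le_mul_of_nonneg_left ?_ (norm_nonneg _)
    refine (Matrix.l2_opNorm_mul _ _).trans ?_
    calc ‖Li‖ * ‖H‖ ≤ 1 / c * 1 := mul_le_mul hLn hH1 (norm_nonneg _) (by positivity)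
      _ = 1 / c := mul_one _
  rw [hdec, rowVec_add, rowVec_add]
  refine (norm_add₃_le).trans ?_
  linarith

/-- The leading eigenvalues of `A`, expressed in the basis `U`, are close to those of `P`. -/
theorem norm_conj_diagonal_sub_le (hV : IsLeadingEigen A V d) (hU : IsLeadingEigen P U l)
    (hP : P.IsSymm) (hPU : U * (Uᵀ * P) = P) {c : ℝ} (hc : 0 < c) (hd : ∀ k, c / 2 ≤ |d k|)
    (hH : ∀ x, 1 / 2 * ‖toLp 2 x‖ ≤ ‖toLp 2 ((Uᵀ * V) *ᵥ x)‖) (hdet : (Uᵀ * V).det ≠ 0) :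
    ‖Uᵀ * V * Matrix.diagonal d * (Uᵀ * V)ᵀ - Matrix.diagonal l‖ ≤
      8 * (‖P‖ / c) * ‖A - P‖ + ‖A - P‖ := by
  have hU1 := norm_le_one_of_transpose_mul_self hU.orthonormal
  have hV1 := norm_le_one_of_transpose_mul_self hV.orthonormal
  have hR := norm_eigenvectors_sub_le hV hU hPU (half_pos hc) hd
  have hcomm := diagonal_mul_sub_mul_diagonal hV hU hP
  set H := Uᵀ * V with hHdef
  have hH1 : ‖H‖ ≤ 1 := by
    refine (Matrix.l2_opNorm_mul _ _).trans ?_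
    rw [norm_transpose_eq]
    exact mul_le_one₀ hU1 (norm_nonneg _) hV1
  have hinv : ‖H⁻¹‖ ≤ 2 := by
    refine opNorm_le_of_mulVec zero_le_two fun x => ?_
    have := hH (H⁻¹ *ᵥ x)
    rw [Matrix.mulVec_mulVec, Matrix.mul_nonsing_inv _ hdet.isUnit, Matrix.one_mulVec] at this
    linarith
  -- `Vᵀ (V - U H) = 1 - Hᵀ H`, and conjugation by `H` exchanges `Hᵀ H` and `H Hᵀ`.
  have h1 : H * Hᵀ - 1 = -(H * (Vᵀ * (V - U * H)) * H⁻¹) := by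
    have e : Vᵀ * (V - U * H) = 1 - Hᵀ * H := by
      rw [Matrix.mul_sub, hV.orthonormal, ← Matrix.mul_assoc, hHdef, Matrix.transpose_mul,
        Matrix.transpose_transpose]
    rw [e, mul_sub, mul_one, sub_mul, Matrix.mul_nonsing_inv _ hdet.isUnit, mul_assoc, mul_assoc,
      Matrix.mul_nonsing_inv _ hdet.isUnit, mul_one]
    abel
  have h2 : ‖H * Hᵀ - 1‖ ≤ 8 * ‖A - P‖ / c := by
    rw [h1, norm_neg]
    have e1 : ‖Vᵀ * (V - U * H)‖ ≤ 2 * ‖A - P‖ / (c / 2) := by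
      refine (Matrix.l2_opNorm_mul _ _).trans ?_
      rw [norm_transpose_eq]
      exact (mul_le_of_le_one_left (norm_nonneg _) hV1).trans hR
    have e2 : ‖H * (Vᵀ * (V - U * H))‖ ≤ 2 * ‖A - P‖ / (c / 2) :=
      (Matrix.l2_opNorm_mul _ _).trans ((mul_le_of_le_one_left (norm_nonneg _) hH1).trans e1)
    refine (Matrix.l2_opNorm_mul _ _).trans ((mul_le_mul e2 hinv (norm_nonneg _)
      (by positivity)).trans (le_of_eq ?_))
    field_simp
    ring
  have h3 : ‖(Matrix.diagonal l : Matrix (Fin K) (Fin K) ℝ)‖ ≤ ‖P‖ := by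
    have e : (Matrix.diagonal l : Matrix (Fin K) (Fin K) ℝ) = Uᵀ * (P * U) := by
      rw [hU.eigen, ← Matrix.mul_assoc, hU.orthonormal, Matrix.one_mul]
    rw [e]
    refine (Matrix.l2_opNorm_mul _ _).trans ?_
    rw [norm_transpose_eq]
    refine (mul_le_of_le_one_left (norm_nonneg _) hU1).trans ?_
    exact (Matrix.l2_opNorm_mul _ _).trans (mul_le_of_le_one_right (norm_nonneg _) hU1)
  have h4 : ‖Uᵀ * ((A - P) * V) * Hᵀ‖ ≤ ‖A - P‖ := by
    refine (Matrix.l2_opNorm_mul _ _).trans ?_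
    rw [norm_transpose_eq]
    refine (mul_le_of_le_one_right (norm_nonneg _) hH1).trans ?_
    refine (Matrix.l2_opNorm_mul _ _).trans ?_
    rw [norm_transpose_eq]
    refine (mul_le_of_le_one_left (norm_nonneg _) hU1).trans ?_
    exact (Matrix.l2_opNorm_mul _ _).trans (mul_le_of_le_one_right (norm_nonneg _) hV1)
  have h5 : H * Matrix.diagonal d * Hᵀ - Matrix.diagonal l =
      Matrix.diagonal l * (H * Hᵀ - 1) + Uᵀ * ((A - P) * V) * Hᵀ := by
    rw [hcomm, add_mul, mul_sub, mul_one, mul_assoc]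
    abel
  rw [h5]
  refine (norm_add_le _ _).trans (add_le_add ?_ h4)
  refine (Matrix.l2_opNorm_mul _ _).trans ((mul_le_mul h3 h2 (norm_nonneg _)
    (norm_nonneg _)).trans (le_of_eq ?_))
  ring

end EigenspacePerturbation

/-! ### Consequences of identifiability -/

section Model

open WithLp

variable {n K : ℕ} {Θ : Matrix (Fin n) (Fin K) ℝ} {B : Matrix (Fin K) (Fin K) ℝ}

theorem IsIdentifiable.exists_pure (h : IsIdentifiable Θ B) :
    ∃ p : Fin K → Fin n, (∀ k, Θ (p k) k = 1) ∧ Θ.submatrix p id = 1 := by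
  choose p hp using h.pure_node
  refine ⟨p, hp, ?_⟩
  ext k l
  rw [Matrix.submatrix_apply, id]
  by_cases hkl : k = l
  · subst hkl
    rw [hp, Matrix.one_apply_eq]
  · rw [Matrix.one_apply_ne hkl]
    have h1 : Θ (p k) k + Θ (p k) l ≤ ∑ j, Θ (p k) j := by
      rw [← Finset.sum_pair hkl]
      exact Finset.sum_le_sum_of_subset_of_nonneg (Finset.subset_univ _)
        fun j _ _ => (h.membership_mem _ _).1
    rw [h.row_sum, hp] at h1
    have := (h.membership_mem (p k) l).1
    linarith

theorem probMatrix_isSymm (h : IsIdentifiable Θ B) : (probMatrix Θ B).IsSymm := by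
  rw [Matrix.IsSymm, probMatrix, Matrix.transpose_mul, Matrix.transpose_mul,
    Matrix.transpose_transpose, h.symm.eq, Matrix.mul_assoc]

theorem submatrix_mul_eq {m : ℕ} {p : Fin K → Fin n} (hp : Θ.submatrix p id = 1)
    (M : Matrix (Fin K) (Fin m) ℝ) : (Θ * M).submatrix p (id : Fin m → Fin m) = M := by
  have := Matrix.submatrix_mul Θ M p id (id : Fin m → Fin m) Function.bijective_id
  rw [this, hp, Matrix.submatrix_id_id, Matrix.one_mul]

/-- `B` is the compression of `P` to pure nodes, so `P` has rank at least `K`. -/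
theorem singVal_probMatrix_pos (h : IsIdentifiable Θ B) (hK : 0 < K) :
    0 < singVal K (probMatrix Θ B) := by
  obtain ⟨p, -, hp⟩ := h.exists_pure
  rw [singVal, LinearMap.singularValues_pos_iff_lt_finrank_range]
  have h1 : B = ((1 : Matrix (Fin n) (Fin n) ℝ).submatrix p id * probMatrix Θ B) *
      ((1 : Matrix (Fin n) (Fin n) ℝ).submatrix p id)ᵀ := by
    have h2 : (1 : Matrix (Fin n) (Fin n) ℝ).submatrix p id * Θ = 1 := by
      rw [← hp]
      ext i j
      simp [Matrix.mul_apply, Matrix.one_apply]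
    rw [probMatrix, ← Matrix.mul_assoc, ← Matrix.mul_assoc, h2, Matrix.one_mul, Matrix.mul_assoc,
      ← Matrix.transpose_mul, h2, Matrix.transpose_one, Matrix.mul_one]
  have h3 : K ≤ (probMatrix Θ B).rank := by
    calc K = B.rank := h.full_rank.symm
      _ ≤ ((1 : Matrix (Fin n) (Fin n) ℝ).submatrix p id * probMatrix Θ B).rank := by
          conv_lhs => rw [h1]
          exact Matrix.rank_mul_le_left _ _
      _ ≤ _ := Matrix.rank_mul_le_right _ _
  have h4 : (probMatrix Θ B).rank =
      Module.finrank ℝ (Matrix.toEuclideanLin (probMatrix Θ B)).range :=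
    Matrix.rank_eq_finrank_range_toLin _ (EuclideanSpace.basisFun _ ℝ).toBasis
      (EuclideanSpace.basisFun _ ℝ).toBasis
  omega

theorem singVal_membership_pos (h : IsIdentifiable Θ B) (hK : 0 < K) : 0 < singVal K Θ := by
  obtain ⟨p, -, hp⟩ := h.exists_pure
  have hinj : Function.Injective (Matrix.toEuclideanLin Θ) := by
    refine (injective_iff_map_eq_zero _).2 fun x hx => ?_
    have h1 : Θ *ᵥ ofLp x = 0 := congrArg ofLp hx
    have h2 : (Θ.submatrix p id) *ᵥ ofLp x = 0 := by
      ext k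
      exact congrFun h1 (p k)
    rw [hp, Matrix.one_mulVec] at h2
    ext k
    exact congrFun h2 k
  refine (LinearMap.injective_iff_forall_lt_finrank_singularValues_pos _).1 hinj _ ?_
  rw [finrank_euclideanSpace_fin]
  omega

theorem norm_toLp_one {m : ℕ} : ‖toLp 2 (fun _ : Fin m => (1 : ℝ))‖ = √m := by
  rw [EuclideanSpace.norm_eq]
  simp

/-- `Θ` maps the all-ones vector to the all-ones vector. This trades the `√n` from summing `n` row
bounds for `‖Θ‖ √K`. -/
theorem sqrt_le_norm_membership_mul (h : IsIdentifiable Θ B) : √n ≤ ‖Θ‖ * √K := by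
  rw [← norm_toLp_one, ← norm_toLp_one (m := K)]
  refine le_trans (le_of_eq ?_) (norm_mulVec_le Θ fun _ => 1)
  congr 2
  ext i
  simp [Matrix.mulVec, dotProduct, h.row_sum i]

/-- Rows of `Θ * M` are convex combinations of the rows of `M`. -/
theorem norm_rowVec_membership_mul_le (h : IsIdentifiable Θ B) {m : ℕ}
    {M : Matrix (Fin K) (Fin m) ℝ} {ρ : ℝ} (hM : ∀ k, ‖rowVec M k‖ ≤ ρ) (i : Fin n) :
    ‖rowVec (Θ * M) i‖ ≤ ρ := by
  have h1 : rowVec (Θ * M) i = ∑ k, Θ i k • rowVec M k := by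
    ext j
    simp [rowVec, Matrix.mul_apply]
  rw [h1]
  calc ‖∑ k, Θ i k • rowVec M k‖ ≤ ∑ k, Θ i k * ρ := by
        refine norm_sum_le_of_le _ fun k _ => ?_
        rw [norm_smul, Real.norm_of_nonneg (h.membership_mem i k).1]
        exact mul_le_mul_of_nonneg_left (hM k) (h.membership_mem i k).1
    _ = ρ := by rw [← Finset.sum_mul, h.row_sum, one_mul]

theorem betaRow_le_beta (A P : Matrix (Fin n) (Fin n) ℝ) (U : Matrix (Fin n) (Fin K) ℝ)
    (i : Fin n) : betaRow A P U i ≤ beta A P U :=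
  le_ciSup (f := betaRow A P U) (Set.finite_range _).bddAbove i

theorem frobNorm_conj_sub_le {Fh M : Matrix (Fin K) (Fin K) ℝ} (D : Matrix (Fin K) (Fin K) ℝ) :
    frobNorm (Fh * D * Fhᵀ - M * D * Mᵀ) ≤
      frobNorm (Fh - M) * (‖D‖ * (‖Fh‖ + ‖M‖)) := by
  have h1 : Fh * D * Fhᵀ - M * D * Mᵀ = (Fh - M) * (D * Fhᵀ) + M * D * (Fh - M)ᵀ := by
    rw [Matrix.transpose_sub, mul_sub, sub_mul, mul_assoc, mul_assoc M D Fhᵀ]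
    abel
  have h2 : frobNorm ((Fh - M) * (D * Fhᵀ)) ≤ frobNorm (Fh - M) * (‖D‖ * ‖Fh‖) := by
    refine (frobNorm_mul_le_left _ _).trans
      (mul_le_mul_of_nonneg_left ?_ (frobNorm_nonneg _))
    rw [← norm_transpose_eq Fh]
    exact Matrix.l2_opNorm_mul _ _
  have h3 : frobNorm (M * D * (Fh - M)ᵀ) ≤ frobNorm (Fh - M) * (‖D‖ * ‖M‖) := by
    refine (frobNorm_mul_le_right _ _).trans ?_
    rw [frobNorm_transpose, mul_comm, mul_comm ‖D‖]
    exact mul_le_mul_of_nonneg_left (Matrix.l2_opNorm_mul _ _) (frobNorm_nonneg _)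
  rw [h1]
  refine (frobNorm_add_le _ _).trans ?_
  linarith

end Model

/-! ### Recovery of the vertices from noisy rows -/

section Estimation

open WithLp

variable {n K : ℕ} {Θ : Matrix (Fin n) (Fin K) ℝ} {B F H : Matrix (Fin K) (Fin K) ℝ}
  {V : Matrix (Fin n) (Fin K) ℝ}

/-- If the rows of `V` are close to those of `Θ F H`, then the preconditioned successive projection
algorithm for the rows of `V` finds approximations of all rows of `F H`. -/
theorem IsPreconditionedSPAOutput.exists_perm_rowVec_le (h : IsIdentifiable Θ B) {a b β : ℝ}
    (ha : 0 < a) (hab : 1 ≤ a * b) (hFdet : F.det ≠ 0)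
    (hFlow : ∀ x, ‖toLp 2 x‖ ≤ a * ‖toLp 2 (F *ᵥ x)‖) (hFb : ‖F‖ ≤ b)
    (hHdet : H.det ≠ 0) (hHlow : ∀ x, 1 / 2 * ‖toLp 2 x‖ ≤ ‖toLp 2 (H *ᵥ x)‖) (hH1 : ‖H‖ ≤ 1)
    (hβ0 : 0 ≤ β) (hβ : √K * β * a ≤ 1 / 50000)
    (hrow : ∀ i, ‖rowVec (V - Θ * F * H) i‖ ≤ β) {J : Fin K → Fin n}
    (hJ : IsPreconditionedSPAOutput (rowVec V) J) :
    ∃ σ : Equiv.Perm (Fin K), ∀ k,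
      ‖rowVec (V.submatrix J id - (F.submatrix σ id) * H) k‖ ≤ 5123 * (a * b * β) := by
  obtain ⟨p, hp1, hp⟩ := h.exists_pure
  set R := V - Θ * F * H with hR
  set Rp := R.submatrix p (id : Fin K → Fin K) with hRp
  -- Coordinates are taken from the actual rows of `V` at pure nodes, not from `F H`, so that these
  -- rows become unit vectors exactly.
  set G := V.submatrix p (id : Fin K → Fin K) with hG
  have hGeq : G = F * H + Rp := by
    have h1 : (Θ * F * H).submatrix p (id : Fin K → Fin K) = F * H := by
      rw [Matrix.mul_assoc]
      exact submatrix_mul_eq hp _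
    have h2 : Rp = G - (Θ * F * H).submatrix p (id : Fin K → Fin K) := rfl
    rw [h2, h1]
    abel
  have hRprow : ∀ k, ‖rowVec Rp k‖ ≤ β := fun k => hrow (p k)
  have hRpn : ‖Rp‖ ≤ √K * β := (norm_le_frobNorm _).trans (frobNorm_le_of_rowVec hβ0 hRprow)
  have hRpa : ‖Rp‖ ≤ 1 / 50000 * (1 / a) := by
    rw [mul_one_div, le_div_iff₀ ha]
    exact (mul_le_mul_of_nonneg_right hRpn ha.le).trans hβ
  have hFT : ∀ x, 1 / a * ‖toLp 2 x‖ ≤ ‖toLp 2 (Fᵀ *ᵥ x)‖ :=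
    lower_bound_transpose hFdet (by positivity) fun x => by
      rw [one_div_mul_eq_div, div_le_iff₀ ha, mul_comm]
      exact hFlow x
  have hHT : ∀ x, 1 / 2 * ‖toLp 2 x‖ ≤ ‖toLp 2 (Hᵀ *ᵥ x)‖ :=
    lower_bound_transpose hHdet (by norm_num) hHlow
  have hGT : ∀ x, 1 / (4 * a) * ‖toLp 2 x‖ ≤ ‖toLp 2 (Gᵀ *ᵥ x)‖ := by
    intro x
    have h1 : Gᵀ *ᵥ x = Hᵀ *ᵥ (Fᵀ *ᵥ x) + Rpᵀ *ᵥ x := by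
      rw [hGeq, Matrix.transpose_add, Matrix.transpose_mul, Matrix.add_mulVec,
        Matrix.mulVec_mulVec]
    have h2 := norm_mulVec_le Rpᵀ x
    rw [norm_transpose_eq] at h2
    have h3 : ‖Rp‖ * ‖toLp 2 x‖ ≤ 1 / 50000 * (1 / a) * ‖toLp 2 x‖ :=
      mul_le_mul_of_nonneg_right hRpa (norm_nonneg _)
    have h4 := hHT (Fᵀ *ᵥ x)
    have h5 := hFT x
    have h6 : ‖toLp 2 (Hᵀ *ᵥ (Fᵀ *ᵥ x))‖ ≤ ‖toLp 2 (Gᵀ *ᵥ x)‖ + ‖toLp 2 (Rpᵀ *ᵥ x)‖ := by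
      have h7 : toLp 2 (Hᵀ *ᵥ (Fᵀ *ᵥ x)) = toLp 2 (Gᵀ *ᵥ x) - toLp 2 (Rpᵀ *ᵥ x) := by
        rw [h1, toLp_add, add_sub_cancel_right]
      rw [h7]
      exact norm_sub_le _ _
    have h8 : 0 ≤ 1 / a * ‖toLp 2 x‖ := by positivity
    have h9 : 1 / (4 * a) * ‖toLp 2 x‖ = 1 / 4 * (1 / a * ‖toLp 2 x‖) := by
      field_simp
    rw [h9]
    linarith
  have hGdet : G.det ≠ 0 := by
    rw [← Matrix.det_transpose]
    intro h0
    obtain ⟨x, hx0, hx⟩ := Matrix.exists_mulVec_eq_zero_iff.2 h0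
    have h1 := hGT x
    rw [hx] at h1
    have h2 : 0 < ‖toLp 2 x‖ := by
      rw [norm_pos_iff]
      intro h0
      exact hx0 (congrArg ofLp h0)
    have h3 : 0 < 1 / (4 * a) * ‖toLp 2 x‖ := by positivity
    simp at h1
    have h4 : 0 < a⁻¹ * 4⁻¹ * ‖toLp 2 x‖ := by positivity
    linarith
  have hGu := hGdet.isUnit
  set Y := V * G⁻¹ with hY
  have hYG : Y * G = V := by
    rw [hY, Matrix.mul_assoc, Matrix.nonsing_inv_mul _ hGu, Matrix.mul_one]
  have hVrow : ∀ i, ‖rowVec (V - Θ * G) i‖ ≤ 2 * β := by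
    intro i
    have h1 : V - Θ * G = R - Θ * Rp := by
      rw [hGeq, Matrix.mul_add, hR, ← Matrix.mul_assoc]
      abel
    rw [h1, rowVec_sub]
    refine (norm_sub_le _ _).trans ?_
    have := norm_rowVec_membership_mul_le h hRprow i
    linarith [hrow i]
  have hYrow : ∀ i, ‖toLp 2 (Y i - Θ i)‖ ≤ 8 * a * β := by
    intro i
    have h1 := hGT (Y i - Θ i)
    have h2 : rowVec (V - Θ * G) i = toLp 2 (Gᵀ *ᵥ (Y i - Θ i)) := by
      rw [← hYG, ← Matrix.sub_mul, rowVec_mul]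
      rfl
    rw [← h2] at h1
    have h3 := h1.trans (hVrow i)
    rw [one_div_mul_eq_div, div_le_iff₀ (by positivity)] at h3
    linarith
  have hYp : ∀ k, Y (p k) = Pi.single k 1 := by
    intro k
    have h1 : Y.submatrix p id = 1 := by
      have h2 := Matrix.submatrix_mul V G⁻¹ p id (id : Fin K → Fin K) Function.bijective_id
      rw [← hY, Matrix.submatrix_id_id] at h2
      rw [h2]
      exact Matrix.mul_nonsing_inv _ hGu
    ext j
    have h3 := congrFun (congrFun h1 k) j
    rw [Matrix.submatrix_apply, id] at h3
    rw [h3, Matrix.one_apply, Pi.single_apply]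
    simp [eq_comm]
  -- `η` is the row error `2 β` times the bound `4 a` for the inverse of `G`.
  obtain ⟨σ, hσ⟩ := IsPreconditionedSPAOutput.exists_perm (θ := Θ) (y := Y)
    (fun i l => (h.membership_mem i l).1) h.row_sum hp1 hYp (η := 8 * a * β) (by positivity) hYrow
    (by
      calc √K * (8 * a * β) = 8 * (√K * β * a) := by ring
        _ ≤ 8 * (1 / 50000) := by gcongr
        _ ≤ _ := by norm_num) hGdet (g := rowVec V) (fun i => by
      rw [← rowVec_mul, hYG]) hJ
  refine ⟨σ, fun k => ?_⟩
  have hdec : rowVec (V.submatrix J id - (F.submatrix σ id) * H) k =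
      toLp 2 (Gᵀ *ᵥ (Θ (J k) - Pi.single (σ k) 1)) + rowVec (V - Θ * G) (J k) +
        rowVec Rp (σ k) := by
    have h1 : rowVec ((F.submatrix σ id) * H) k = rowVec (F * H) (σ k) := by
      rw [rowVec_mul, rowVec_mul]
      rfl
    have h2 : toLp 2 (Gᵀ *ᵥ Θ (J k)) = rowVec (Θ * G) (J k) := (rowVec_mul _ _ _).symm
    have h3 : toLp 2 (Gᵀ *ᵥ Pi.single (σ k) 1) = rowVec G (σ k) := by
      rw [Matrix.mulVec_single_one]
      rfl
    rw [Matrix.mulVec_sub, toLp_sub, h2, h3, rowVec_sub, rowVec_sub, h1, hGeq, rowVec_add]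
    change rowVec V (J k) - _ = _
    abel
  have hGn : ‖G‖ ≤ 2 * b := by
    have h1 : ‖F * H‖ ≤ b :=
      ((Matrix.l2_opNorm_mul _ _).trans (mul_le_of_le_one_right (norm_nonneg _) hH1)).trans hFb
    have h2 : 1 / a ≤ b := by rw [div_le_iff₀ ha]; linarith
    have h3 : 0 ≤ 1 / a := by positivity
    rw [hGeq]
    refine (norm_add_le _ _).trans ?_
    linarith
  have hθ : ‖toLp 2 (Θ (J k) - Pi.single (σ k) 1)‖ ≤ 2560 * a * β := by
    have h1 := norm_sum_smul_sub_le (E := EuclideanSpace ℝ (Fin K))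
      (fun l => (h.membership_mem (J k) l).1) (h.row_sum (J k))
      (v := fun l => toLp 2 (Pi.single l (1 : ℝ))) (c := 1) (fun l =>
        ((PiLp.norm_single 2 (fun _ : Fin K => ℝ) l (1 : ℝ)).trans (by simp)).le) (σ k)
    have h2 : toLp 2 (Θ (J k) - Pi.single (σ k) 1) =
        (∑ l, Θ (J k) l • toLp 2 (Pi.single l (1 : ℝ)) -
          toLp 2 (Pi.single (σ k) (1 : ℝ)) : EuclideanSpace ℝ (Fin K)) := by
      ext j
      simp [Pi.single_apply]
    rw [h2]
    linarith [hσ k]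
  have hb0 : 0 ≤ b := (norm_nonneg _).trans hFb
  have h1 : ‖toLp 2 (Gᵀ *ᵥ (Θ (J k) - Pi.single (σ k) 1))‖ ≤ 2 * b * (2560 * a * β) := by
    refine (norm_mulVec_le _ _).trans ?_
    rw [norm_transpose_eq]
    exact mul_le_mul hGn hθ (norm_nonneg _) (by positivity)
  rw [hdec]
  -- The constant is `5123 = 2 * 2560 + 2 + 1`, with `2560 = 2 * 160 * 8`.
  refine (norm_add₃_le).trans ?_
  have h2 := hVrow (J k)
  have h3 := hRprow (σ k)
  have h4 : β ≤ a * b * β := le_mul_of_one_le_left hβ0 hab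
  linarith

end Estimation

/-! ### The error bound for SPOC -/

section SPOCBound

open WithLp

variable {n K : ℕ} {Θ : Matrix (Fin n) (Fin K) ℝ} {B F Bhat : Matrix (Fin K) (Fin K) ℝ}
  {A P : Matrix (Fin n) (Fin n) ℝ} {U : Matrix (Fin n) (Fin K) ℝ} {l : Fin K → ℝ}

/-- The error bound for the output of the SPOC algorithm, with explicit constants. -/
theorem IsSPOCOutput.exists_perm_frobNorm_le (hK : 0 < K) (h : IsIdentifiable Θ B)
    (hPdef : P = probMatrix Θ B) (hA : A.IsSymm) (hU : IsLeadingEigen P U l) (hUF : U = Θ * F)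
    (hE : ‖A - P‖ ≤ 1 / 2 * singVal K P) (hβ : beta A P U ≤ 1 / 50000 * singVal K F / √K)
    (hout : IsSPOCOutput A Bhat) :
    ∃ σ : Equiv.Perm (Fin K),
      frobNorm (Bhat - σ.permMatrix ℝ * B * (σ.permMatrix ℝ)ᵀ) ≤
        30000 * √K * condNum K Θ * (‖P‖ / singVal K Θ) * beta A P U
        + 30000 * √K * condNum K P * (‖A - P‖ / singVal K Θ ^ 2) := by
  obtain ⟨V, d, J, hV, hJ, hBhat⟩ := hout
  obtain ⟨p, hp1, hp⟩ := h.exists_pure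
  have hP : P.IsSymm := hPdef ▸ probMatrix_isSymm h
  set lam := singVal K P with hlam
  have hlam0 : 0 < lam := by rw [hlam, hPdef]; exact singVal_probMatrix_pos h hK
  set β := beta A P U with hβdef
  set sΘ := singVal K Θ with hsΘ
  have hsΘ0 : 0 < sΘ := singVal_membership_pos h hK
  set a := ‖Θ‖ with ha
  set b := 1 / sΘ with hb
  set sF := singVal K F with hsF
  have hsF0 : 0 ≤ sF := LinearMap.singularValues_nonneg _ _
  have hK1 : 1 ≤ √(K : ℝ) := by
    rw [Real.one_le_sqrt]; exact_mod_cast hK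
  have hK0 : 0 < √(K : ℝ) := by linarith
  have hU1 := norm_le_one_of_transpose_mul_self hU.orthonormal
  have hV1 := norm_le_one_of_transpose_mul_self hV.orthonormal
  have hUn := norm_mulVec_of_transpose_mul_self hU.orthonormal
  have hVn := norm_mulVec_of_transpose_mul_self hV.orthonormal
  have hFinv : (Fᵀ * Θᵀ * Θ) * F = 1 := by
    have := hU.orthonormal
    rw [hUF, Matrix.transpose_mul] at this
    rw [← this, Matrix.mul_assoc]
  have hFdet : F.det ≠ 0 := by
    have := congrArg Matrix.det hFinv
    rw [Matrix.det_mul, Matrix.det_one] at this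
    exact right_ne_zero_of_mul_eq_one this
  -- As `U = Θ F` is an isometry, the singular values of `F` are the reciprocals of those of `Θ`;
  -- `hFlow`, `hFb` and `hsFa` are the inequalities needed.
  have hFlow : ∀ x, ‖toLp 2 x‖ ≤ a * ‖toLp 2 (F *ᵥ x)‖ := by
    intro x
    rw [← hUn x, hUF, ← Matrix.mulVec_mulVec]
    exact norm_mulVec_le _ _
  have hFb : ‖F‖ ≤ b := by
    refine opNorm_le_of_mulVec (by positivity) fun x => ?_
    have h1 := singVal_mul_norm_le Θ (F *ᵥ x)
    rw [Matrix.mulVec_mulVec, ← hUF, hUn] at h1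
    rw [hb, one_div_mul_eq_div, le_div_iff₀ hsΘ0, mul_comm]
    exact h1
  have hΘU : Θ = U * F⁻¹ := by
    rw [hUF, Matrix.mul_assoc, Matrix.mul_nonsing_inv _ hFdet.isUnit, Matrix.mul_one]
  have hsFa : sF * a ≤ 1 := by
    rcases hsF0.eq_or_lt with h0 | h0
    · rw [← h0]; simp
    · have h1 : a ≤ 1 / sF := by
        refine opNorm_le_of_mulVec (by positivity) fun x => ?_
        have h2 := singVal_mul_norm_le F (F⁻¹ *ᵥ x)
        rw [Matrix.mulVec_mulVec, Matrix.mul_nonsing_inv _ hFdet.isUnit, Matrix.one_mulVec] at h2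
        rw [hΘU, ← Matrix.mulVec_mulVec, hUn, one_div_mul_eq_div, le_div_iff₀ h0, mul_comm]
        exact h2
      rw [le_div_iff₀ h0] at h1
      linarith
  have hn0 : 0 < n := lt_of_le_of_lt (Nat.zero_le _) (p ⟨0, hK⟩).2
  have hna : √n ≤ a * √K := sqrt_le_norm_membership_mul h
  have ha0 : 0 < a := by
    have h1 : 0 < √(n : ℝ) := Real.sqrt_pos.2 (by exact_mod_cast hn0)
    have h2 : 0 < a * √K := lt_of_lt_of_le h1 hna
    exact pos_of_mul_pos_left h2 hK0.le
  have hab : 1 ≤ a * b := by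
    have h1 := singVal_mul_norm_le Θ (Pi.single ⟨0, hK⟩ 1)
    have h2 : ‖toLp 2 (Pi.single ⟨0, hK⟩ (1 : ℝ) : Fin K → ℝ)‖ = 1 :=
      (PiLp.norm_single 2 (fun _ : Fin K => ℝ) ⟨0, hK⟩ (1 : ℝ)).trans (by simp)
    have h3 := h1.trans (norm_mulVec_le Θ _)
    rw [h2, mul_one, mul_one] at h3
    rw [hb, mul_one_div, le_div_iff₀ hsΘ0, one_mul]
    exact h3
  have hPU : U * (Uᵀ * P) = P := by
    have h1 : U * (Uᵀ * Θ) = Θ := by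
      rw [hΘU, ← Matrix.mul_assoc Uᵀ, hU.orthonormal, Matrix.one_mul]
    rw [hPdef, probMatrix, Matrix.mul_assoc Θ, ← Matrix.mul_assoc Uᵀ, ← Matrix.mul_assoc U, h1]
  -- Both sides are the restriction of `P` to pure nodes.
  have hBF : B = F * Matrix.diagonal l * Fᵀ := by
    have h1 : P = Θ * (F * Matrix.diagonal l * Fᵀ) * Θᵀ := by
      have h2 : P = U * Matrix.diagonal l * Uᵀ := by
        rw [Matrix.mul_assoc, ← hU.transpose_mul hP, hPU]
      rw [h2, hUF, Matrix.transpose_mul]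
      simp only [Matrix.mul_assoc]
    have h3 : ∀ M : Matrix (Fin K) (Fin K) ℝ, (Θ * M * Θᵀ).submatrix p p = M := by
      intro M
      have h4 := Matrix.submatrix_mul (Θ * M) Θᵀ p (id : Fin K → Fin K) p Function.bijective_id
      rw [h4, submatrix_mul_eq hp]
      have h5 : Θᵀ.submatrix id p = (1 : Matrix (Fin K) (Fin K) ℝ) := by
        rw [← Matrix.transpose_submatrix, hp, Matrix.transpose_one]
      rw [h5, mul_one]
    rw [← h3 B, ← h3 (F * Matrix.diagonal l * Fᵀ), ← h1, hPdef, probMatrix]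
  have hl : ∀ k, lam ≤ |l k| := hU.singVal_le hP
  have hd : ∀ k, lam / 2 ≤ |d k| := fun k => by
    have := hV.singVal_sub_le hA hP hU k
    linarith
  have hlamP : lam ≤ ‖P‖ := by
    have h1 : (Matrix.diagonal l : Matrix (Fin K) (Fin K) ℝ) = Uᵀ * (P * U) := by
      rw [hU.eigen, ← Matrix.mul_assoc, hU.orthonormal, Matrix.one_mul]
    have h2 : ‖(Matrix.diagonal l : Matrix (Fin K) (Fin K) ℝ)‖ ≤ ‖P‖ := by
      rw [h1]
      refine (Matrix.l2_opNorm_mul _ _).trans ?_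
      rw [norm_transpose_eq]
      refine (mul_le_of_le_one_left (norm_nonneg _) hU1).trans ?_
      exact (Matrix.l2_opNorm_mul _ _).trans (mul_le_of_le_one_right (norm_nonneg _) hU1)
    rw [Matrix.l2_opNorm_diagonal] at h2
    exact (hl ⟨0, hK⟩).trans ((norm_le_pi_norm l ⟨0, hK⟩).trans h2)
  have hκP : ‖P‖ / lam ≤ condNum K P :=
    div_le_div_of_nonneg_right (norm_le_singVal_one P) hlam0.le
  have hκ1 : 1 ≤ condNum K P := le_trans (by rwa [one_le_div hlam0]) hκP
  have hκΘ : a * b ≤ condNum K Θ := by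
    rw [hb, mul_one_div]
    exact div_le_div_of_nonneg_right (norm_le_singVal_one Θ) hsΘ0.le
  set H := Uᵀ * V with hH
  have hrow : ∀ i, ‖rowVec (V - U * H) i‖ ≤ β := by
    intro i
    refine (norm_rowVec_eigenvectors_sub_le hV hU hP hPU hlam0 hd hl i).trans
      (le_trans ?_ (betaRow_le_beta A P U i))
    rw [betaRow, ← mul_div_assoc]
    refine add_le_add ?_ le_rfl
    rw [← mul_div_assoc]
    gcongr
    calc (10 : ℝ) ≤ 23 * 1 * 1 := by norm_num
      _ ≤ 23 * √K * condNum K P := by gcongr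
  have hβ0 : 0 ≤ β := (norm_nonneg _).trans (hrow ⟨0, hn0⟩)
  have hβ1 : √K * β ≤ 1 / 50000 * sF := by
    rw [le_div_iff₀ hK0] at hβ
    linarith
  have hβa : √K * β * a ≤ 1 / 50000 := by
    calc √K * β * a ≤ 1 / 50000 * sF * a := by gcongr
      _ = 1 / 50000 * (sF * a) := by ring
      _ ≤ 1 / 50000 * 1 := by gcongr
      _ = _ := mul_one _
  -- The spectral estimate `4 ‖A - P‖ / lam` may be as large as `2`, too weak to make `H`
  -- invertible; the summed row bounds suffice.
  have hRn : ‖V - U * H‖ ≤ 1 / 50000 := by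
    calc ‖V - U * H‖ ≤ √n * β := (norm_le_frobNorm _).trans (frobNorm_le_of_rowVec hβ0 hrow)
      _ ≤ a * √K * β := by gcongr
      _ = √K * β * a := by ring
      _ ≤ _ := hβa
  have hHlow : ∀ x, 1 / 2 * ‖toLp 2 x‖ ≤ ‖toLp 2 (H *ᵥ x)‖ := by
    intro x
    have h1 : toLp 2 (V *ᵥ x) = toLp 2 ((V - U * H) *ᵥ x) + toLp 2 (U *ᵥ (H *ᵥ x)) := by
      rw [← toLp_add, Matrix.sub_mulVec, Matrix.mulVec_mulVec, sub_add_cancel]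
    have h2 := norm_add_le (toLp 2 ((V - U * H) *ᵥ x)) (toLp 2 (U *ᵥ (H *ᵥ x)))
    rw [← h1, hVn, hUn] at h2
    have h3 := (norm_mulVec_le (V - U * H) x).trans
      (mul_le_mul_of_nonneg_right hRn (norm_nonneg _))
    have h4 := norm_nonneg (toLp 2 x)
    linarith
  have hHdet : H.det ≠ 0 := by
    intro h0
    obtain ⟨x, hx0, hx⟩ := Matrix.exists_mulVec_eq_zero_iff.2 h0
    have h1 := hHlow x
    rw [hx, toLp_zero, norm_zero] at h1
    have h2 : 0 < ‖toLp 2 x‖ := by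
      rw [norm_pos_iff]
      intro h0
      exact hx0 (congrArg ofLp h0)
    linarith
  have hH1 : ‖H‖ ≤ 1 := by
    refine (Matrix.l2_opNorm_mul _ _).trans ?_
    rw [norm_transpose_eq]
    exact mul_le_one₀ hU1 (norm_nonneg _) hV1
  obtain ⟨σ, hσ⟩ := hJ.exists_perm_rowVec_le (F := F) (H := H) h ha0 hab hFdet hFlow hFb
    hHdet hHlow hH1 hβ0 hβa (by rw [← hUF]; exact hrow)
  refine ⟨σ, ?_⟩
  set Fh := V.submatrix J (id : Fin K → Fin K) with hFh
  set Fσ := F.submatrix σ (id : Fin K → Fin K) with hFσ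
  have hb0 : 0 < b := by positivity
  have hFσb : ‖Fσ‖ ≤ b := (norm_submatrix_equiv_le F σ).trans hFb
  have hFσH : ‖Fσ * H‖ ≤ b :=
    ((Matrix.l2_opNorm_mul _ _).trans (mul_le_of_le_one_right (norm_nonneg _) hH1)).trans hFσb
  have hfrob : frobNorm (Fh - Fσ * H) ≤ √K * (5123 * (a * b * β)) :=
    frobNorm_le_of_rowVec (by positivity) hσ
  have hFhb : ‖Fh‖ ≤ 2 * b := by
    have h1 : ‖Fh - Fσ * H‖ ≤ b := by
      refine (norm_le_frobNorm _).trans (hfrob.trans ?_)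
      calc √K * (5123 * (a * b * β)) = 5123 * (√K * β * a) * b := by ring
        _ ≤ 5123 * (1 / 50000) * b := by gcongr
        _ ≤ 1 * b := by gcongr; norm_num
        _ = b := one_mul b
    have h2 := norm_add_le (Fh - Fσ * H) (Fσ * H)
    rw [sub_add_cancel] at h2
    linarith
  have hdn : ‖(Matrix.diagonal d : Matrix (Fin K) (Fin K) ℝ)‖ ≤ 3 / 2 * ‖P‖ := by
    have h1 : (Matrix.diagonal d : Matrix (Fin K) (Fin K) ℝ) = Vᵀ * (A * V) := by
      rw [hV.eigen, ← Matrix.mul_assoc, hV.orthonormal, Matrix.one_mul]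
    have h2 : ‖A‖ ≤ 3 / 2 * ‖P‖ := by
      have := norm_add_le (A - P) P
      rw [sub_add_cancel] at this
      linarith
    rw [h1]
    refine (Matrix.l2_opNorm_mul _ _).trans ?_
    rw [norm_transpose_eq]
    refine (mul_le_of_le_one_left (norm_nonneg _) hV1).trans ?_
    exact ((Matrix.l2_opNorm_mul _ _).trans (mul_le_of_le_one_right (norm_nonneg _) hV1)).trans h2
  -- `T1` is the error in the vertices, `T2` the error in the eigenvalues expressed in the basis
  -- `U`.
  set T1 := Fh * Matrix.diagonal d * Fhᵀ - (Fσ * H) * Matrix.diagonal d * (Fσ * H)ᵀ with hT1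
  set T2 := Fσ * ((H * Matrix.diagonal d * Hᵀ - Matrix.diagonal l) * Fσᵀ) with hT2
  have hdec : Bhat - σ.permMatrix ℝ * B * (σ.permMatrix ℝ)ᵀ = T1 + T2 := by
    have h1 : σ.permMatrix ℝ * B * (σ.permMatrix ℝ)ᵀ = Fσ * Matrix.diagonal l * Fσᵀ := by
      have h2 : σ.permMatrix ℝ * F = Fσ := PEquiv.toMatrix_toPEquiv_mul σ F
      rw [hBF, ← h2, Matrix.transpose_mul]
      simp only [Matrix.mul_assoc]
    rw [h1, hBhat, hT1, hT2, sub_mul, mul_sub, Matrix.transpose_mul]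
    simp only [Matrix.mul_assoc]
    abel
  have hb1 : frobNorm T1 ≤ 30000 * √K * condNum K Θ * (‖P‖ / sΘ) * β := by
    refine (frobNorm_conj_sub_le _).trans ?_
    calc frobNorm (Fh - Fσ * H) * (‖(Matrix.diagonal d : Matrix (Fin K) (Fin K) ℝ)‖ *
          (‖Fh‖ + ‖Fσ * H‖)) ≤
          √K * (5123 * (a * b * β)) * (3 / 2 * ‖P‖ * (2 * b + b)) := by gcongr
      _ = 46107 / 2 * (√K * (a * b) * (‖P‖ * b) * β) := by ring
      _ ≤ 30000 * (√K * condNum K Θ * (‖P‖ * b) * β) := by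
          gcongr
          norm_num
      _ = _ := by rw [hb, mul_one_div]; ring
  have hb2 : frobNorm T2 ≤ 30000 * √K * condNum K P * (‖A - P‖ / sΘ ^ 2) := by
    have h1 := norm_conj_diagonal_sub_le hV hU hP hPU hlam0 hd hHlow hHdet
    rw [← hH] at h1
    have hE0 := norm_nonneg (A - P)
    have h2 : ‖H * Matrix.diagonal d * Hᵀ - Matrix.diagonal l‖ ≤
        9 * condNum K P * ‖A - P‖ := by
      refine h1.trans ?_
      have h3 : ‖P‖ / lam * ‖A - P‖ ≤ condNum K P * ‖A - P‖ := by gcongr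
      have h4 : 1 * ‖A - P‖ ≤ condNum K P * ‖A - P‖ := by gcongr
      linarith
    have h3 : frobNorm (H * Matrix.diagonal d * Hᵀ - Matrix.diagonal l) ≤
        √K * (9 * condNum K P * ‖A - P‖) :=
      (frobNorm_le_sqrt_mul_norm _).trans (by gcongr)
    refine (frobNorm_mul_le_right _ _).trans ?_
    calc ‖Fσ‖ * frobNorm ((H * Matrix.diagonal d * Hᵀ - Matrix.diagonal l) * Fσᵀ) ≤
          ‖Fσ‖ * (frobNorm (H * Matrix.diagonal d * Hᵀ - Matrix.diagonal l) * ‖Fσᵀ‖) := by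
          gcongr
          exact frobNorm_mul_le_left _ _
      _ ≤ b * (√K * (9 * condNum K P * ‖A - P‖) * b) := by
          rw [norm_transpose_eq]
          gcongr
          exact mul_nonneg (frobNorm_nonneg _) (norm_nonneg _)
      _ = 9 * (√K * condNum K P * (‖A - P‖ * b ^ 2)) := by ring
      _ ≤ 30000 * (√K * condNum K P * (‖A - P‖ * b ^ 2)) := by
          gcongr
          norm_num
      _ = _ := by rw [hb, div_pow, one_pow, mul_one_div]; ring
  rw [hdec]
  exact (frobNorm_add_le _ _).trans (add_le_add hb1 hb2)

end SPOCBound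

end SPOC

theorem theorem3 :
    ∃ C c : ℝ, 0 < C ∧ 0 < c ∧
      ∀ (n K : ℕ) (Θ : Matrix (Fin n) (Fin K) ℝ) (B : Matrix (Fin K) (Fin K) ℝ)
        (A P : Matrix (Fin n) (Fin n) ℝ) (U : Matrix (Fin n) (Fin K) ℝ) (l : Fin K → ℝ)
        (F : Matrix (Fin K) (Fin K) ℝ),
        SPOC.IsIdentifiable Θ B →
        P = SPOC.probMatrix Θ B →
        A.IsSymm →
        SPOC.IsLeadingEigen P U l →
        U = Θ * F →
        ‖A - P‖ ≤ 1 / 2 * SPOC.singVal K P →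
        SPOC.beta A P U ≤ c * SPOC.singVal K F / √K →
        ∀ Bhat : Matrix (Fin K) (Fin K) ℝ, SPOC.IsSPOCOutput A Bhat →
          ∃ σ : Equiv.Perm (Fin K),
            SPOC.frobNorm (Bhat - σ.permMatrix ℝ * B * (σ.permMatrix ℝ)ᵀ) ≤
              C * √K * SPOC.condNum K Θ * (‖P‖ / SPOC.singVal K Θ) * SPOC.beta A P U
              + C * √K * SPOC.condNum K P * (‖A - P‖ / SPOC.singVal K Θ ^ 2) := by
  refine ⟨30000, 1 / 50000, by norm_num, by norm_num, ?_⟩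
  intro n K Θ B A P U l F h hP hA hU hUF hE hβ Bhat hout
  rcases Nat.eq_zero_or_pos K with hK | hK
  -- With no communities all matrices in the bound are empty, and both sides vanish.
  · subst hK
    exact ⟨1, by simp [SPOC.frobNorm]⟩
  · exact SPOC.IsSPOCOutput.exists_perm_frobNorm_le hK h hP hA hU hUF hE hβ hout
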